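/- **Setting.** Let $\mathcal E$ be a finite family of regular simple $C^1$ arcs $\gamma:[0,1]\to\mathbb R^N$, closed arcs ($\gamma(0)=\gamma(1)$) being allowed, which contains with $\gamma$ also the reversed arc $\widetilde\gamma(s)=\gamma(1-s)$. Let $\mathbf V$ be the set of all end points (vertices) of the arcs. Assume that $\gamma((0,1))\cap\gamma'((0,1))=\emptyset$ whenever $\gamma'\ne\gamma,\widetilde\gamma$, that $\gamma((0,1))\cap\mathbf V=\emptyset$ for all $\gamma$, and that any two vertices are linked by a finite concatenation of arcs. Put $\Gamma=\bigcup_{\gamma\in\mathcal E}\gamma([0,1])$ with its geodesic distance. Let $\mathbf X=(\mathbf V,\mathbf E)$ be the abstract graph with a bijection $\Psi:\mathbf E\to\mathcal E$, $\mathrm o(e)=\Psi(e)(0)$, $\mathrm t(e)=\Psi(e)(1)$. A path is a nonempty finite sequence of concatenated edges, and a cycle is a path whose initial and final vertices agree. For each $\gamma\in\mathcal E$ let $H_\gamma:[0,1]\times\mathbb R\to\mathbb R$ be continuous, coercive in $p$ and quasiconvex in $p$, with $\operatorname{Int}\{p: H_\gamma(s,p)\le a\}=\{p: H_\gamma(s,p)<a\}$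 for all $s\in[0,1]$, $a\in\mathbb R$, and $H_{\widetilde\gamma}(s,p)=H_\gamma(1-s,-p)$. Set $a_\gamma=\max_{s}\min_p H_\gamma(s,p)$, and let $c_\gamma$ be the least $a$ such that $H_\gamma(s,w')=a$ has a viscosity subsolution in $(0,1)$ that is continuous on $[0,1]$ with $w(0)=w(1)$. Let $a_0$ be the maximum of the numbers $a_\gamma$, $\gamma$ not closed, and $c_\gamma$, $\gamma$ closed. Assume that $s\mapsto\min_pH_\gamma(s,p)$ is constant for every $\gamma$ with $a_\gamma=a_0$. A subsolution of $\mathcal H(x,Du)=a$ on $\Gamma$ is a continuous $u:\Gamma\to\mathbb R$ such that, for every $\gamma\in\mathcal E$, $u\circ\gamma$ is a viscosity subsolution of $H_\gamma(s,w')=a$ in $(0,1)$. A solution is a continuous $u$ such that every $u\circ\gamma$ is a viscosity solution in $(0,1)$ and such that for every vertex $x$ there is an arc $\gamma$ with $\gamma(1)=x$ for which $H_\gamma(1,\varphi'(1))\ge a$ whenever $\varphi\in C^1([0,1])$, $\varphi(1)=u(\gamma(1))$ and $\varphi\le u\circ\gamma$ on some interval $(1-\delta,1)$. For $a\ge a_0$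 and $\gamma=\Psi(e)$ let $\sigma_a(e)=\int_0^1\max\{p: H_\gamma(s,p)=a\}\,ds$, and for a path $\xi=(e_1,\dots,e_M)$ let $\sigma_a(\xi)=\sum_i\sigma_a(e_i)$. The critical value $c$ is the least $a\ge a_0$ for which there is $u:\mathbf V\to\mathbb R$ with $u(\mathrm t(e))\le u(\mathrm o(e))+\sigma_a(e)$ for all $e\in\mathbf E$. Let $\mathcal A^*_{\mathbf X}$ be the set of the edges belonging to some cycle $\xi$ with $\sigma_c(\xi)=0$, and let $$\mathcal A_\Gamma=\{\Psi(e)(t): e\in\mathcal A^*_{\mathbf X},\ t\in[0,1]\}.$$ **Proposition.** Let $y\in\Gamma$ and $\alpha\in\mathbb R$. Then there is a (pointwise) maximal subsolution $w$ of $\mathcal H(x,Du)=c$ on $\Gamma$ with $w(y)=\alpha$, and $w$ is a solution of $\mathcal H(x,Du)=c$ on the whole of $\Gamma$ if and only if $y\in\mathcal A_\Gamma$. -/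

import Mathlib

open Set Filter Topology
open scoped ENNReal

noncomputable section

/-- Finitely many regular simple arcs in `ℝ^N`, parametrized on `[0,1]` and indexed by the (finite) type `E` of
oriented edges of the underlying abstract graph. Only the values of `arc e` on `[0,1]` matter. The family is closed
under reversal of the parametrization, and distinct arcs which are not reversals of each other meet at most at vertices.
Closed arcs (`arc e 0 = arc e 1`) and several arcs with the same end points are allowed. -/
structure EmbeddedNetwork (N : ℕ) (E : Type*) where
  /-- the arc attached to an edge -/
  arc : E → ℝ → EuclideanSpace ℝ (Fin N)
  /-- the edge with the opposite orientation -/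
  rev : E → E
  rev_rev : ∀ e, rev (rev e) = e
  rev_ne : ∀ e, rev e ≠ e
  arc_rev : ∀ e, ∀ s ∈ Icc (0 : ℝ) 1, arc (rev e) s = arc e (1 - s)
  contDiffOn_arc : ∀ e, ContDiffOn ℝ 1 (arc e) (Icc 0 1)
  derivWithin_arc_ne_zero : ∀ e, ∀ s ∈ Icc (0 : ℝ) 1, derivWithin (arc e) (Icc 0 1) s ≠ 0
  simple : ∀ e, ∀ s ∈ Icc (0 : ℝ) 1, ∀ t ∈ Icc (0 : ℝ) 1, s < t → arc e s = arc e t → s = 0 ∧ t = 1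
  disjoint_interiors : ∀ e e', e ≠ e' → e ≠ rev e' →
    Disjoint (arc e '' Ioo 0 1) (arc e' '' Ioo 0 1)
  vertex_notMem_interior : ∀ e e', arc e' 0 ∉ arc e '' Ioo 0 1

namespace EmbeddedNetwork

variable {N : ℕ} {E : Type*} (Γ : EmbeddedNetwork N E)

/-- The network as a subset of `ℝ^N`. -/
def carrier : Set (EuclideanSpace ℝ (Fin N)) := ⋃ e, Γ.arc e '' Icc 0 1

/-- Initial vertex of an edge. -/
def origin (e : E) : EuclideanSpace ℝ (Fin N) := Γ.arc e 0

/-- Terminal vertex of an edge, that is, the initial vertex of the reversed edge. -/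
def terminal (e : E) : EuclideanSpace ℝ (Fin N) := Γ.origin (Γ.rev e)

/-- The set of vertices. -/
def vertices : Set (EuclideanSpace ℝ (Fin N)) := range Γ.origin

/-- `Γ.Chain x ξ y`: the edges of the (possibly empty) list `ξ` are concatenated and lead from `x` to `y`. -/
def Chain : EuclideanSpace ℝ (Fin N) → List E → EuclideanSpace ℝ (Fin N) → Prop
  | x, [], y => x = y
  | x, e :: ξ, y => Γ.origin e = x ∧ Chain (Γ.terminal e) ξ y

/-- `ξ` is a path linking `x` to `y`: a nonempty finite sequence of concatenated edges. It is a cycle if `x = y`. -/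
def IsPath (x : EuclideanSpace ℝ (Fin N)) (ξ : List E) (y : EuclideanSpace ℝ (Fin N)) : Prop :=
  ξ ≠ [] ∧ Γ.Chain x ξ y

/-- Any two vertices are linked by a finite concatenation of arcs. -/
def Connected : Prop :=
  ∀ x ∈ Γ.vertices, ∀ y ∈ Γ.vertices, ∃ ξ, Γ.IsPath x ξ y

/-- The geodesic distance on the network: the infimum of the Euclidean lengths (total variations) of the
continuous curves contained in the network and linking the two points. -/
def geodesicDist (x y : EuclideanSpace ℝ (Fin N)) : ℝ≥0∞ :=
  ⨅ (η : ℝ → EuclideanSpace ℝ (Fin N)) (_ : ContinuousOn η (Icc 0 1) ∧ MapsTo η (Icc 0 1) Γ.carrier ∧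
    η 0 = x ∧ η 1 = y), eVariationOn η (Icc 0 1)

/-- Continuity, with respect to the geodesic distance, of the restriction of `u` to the network. -/
def IsContinuous (u : EuclideanSpace ℝ (Fin N) → ℝ) : Prop :=
  ∀ x ∈ Γ.carrier, ∀ ε > (0 : ℝ), ∃ δ > (0 : ℝ≥0∞), ∀ z ∈ Γ.carrier,
    Γ.geodesicDist x z < δ → |u z - u x| < ε

end EmbeddedNetwork

/-! ### Viscosity notions on the interval

Test functions are `C¹` on `ℝ`; these have the same restrictions to `[0,1]` as the functions of class `C¹` on `[0,1]`. -/

/-- `w` is a viscosity subsolution of `H(s, w') = a` in `(0,1)`. -/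
def IsViscositySubsolution (H : ℝ → ℝ → ℝ) (a : ℝ) (w : ℝ → ℝ) : Prop :=
  ∀ s ∈ Ioo (0 : ℝ) 1, ∀ φ : ℝ → ℝ, ContDiff ℝ 1 φ → φ s = w s →
    (∃ δ > 0, ∀ t ∈ Ioo (s - δ) (s + δ) ∩ Ioo 0 1, w t ≤ φ t) → H s (deriv φ s) ≤ a

/-- `w` is a viscosity supersolution of `H(s, w') = a` in `(0,1)`. -/
def IsViscositySupersolution (H : ℝ → ℝ → ℝ) (a : ℝ) (w : ℝ → ℝ) : Prop :=
  ∀ s ∈ Ioo (0 : ℝ) 1, ∀ φ : ℝ → ℝ, ContDiff ℝ 1 φ → φ s = w s →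
    (∃ δ > 0, ∀ t ∈ Ioo (s - δ) (s + δ) ∩ Ioo 0 1, φ t ≤ w t) → a ≤ H s (deriv φ s)

/-- `w` satisfies the state constraint boundary condition for `H(s, w') = a` at `s = 1`. -/
def StateConstraintAtOne (H : ℝ → ℝ → ℝ) (a : ℝ) (w : ℝ → ℝ) : Prop :=
  ∀ φ : ℝ → ℝ, ContDiff ℝ 1 φ → φ 1 = w 1 →
    (∃ δ > 0, ∀ t ∈ Ioo (1 - δ) 1 ∩ Ioo 0 1, φ t ≤ w t) → a ≤ H 1 (deriv φ 1)

/-- A Hamiltonian on the network: for each arc a function on `[0,1] × ℝ`, compatible with reversal of arcs,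
continuous, coercive and quasiconvex in `p`, the sublevel sets having the strict sublevel sets as interior. -/
structure NetworkHamiltonian {N : ℕ} {E : Type*} (Γ : EmbeddedNetwork N E) where
  /-- the Hamiltonian `H_γ(s,p)` on the arc attached to an edge -/
  toFun : E → ℝ → ℝ → ℝ
  rev_eq : ∀ e, ∀ s ∈ Icc (0 : ℝ) 1, ∀ p, toFun (Γ.rev e) s p = toFun e (1 - s) (-p)
  continuousOn : ∀ e, ContinuousOn (fun q : ℝ × ℝ => toFun e q.1 q.2) (Icc 0 1 ×ˢ univ)
  coercive : ∀ e, ∀ s ∈ Icc (0 : ℝ) 1, Tendsto (toFun e s) (cocompact ℝ) atTop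
  quasiconvex : ∀ e, ∀ s ∈ Icc (0 : ℝ) 1, QuasiconvexOn ℝ univ (toFun e s)
  interior_sublevel : ∀ e, ∀ s ∈ Icc (0 : ℝ) 1, ∀ a : ℝ,
    interior {p | toFun e s p ≤ a} = {p | toFun e s p < a}

namespace NetworkHamiltonian

variable {N : ℕ} {E : Type*} {Γ : EmbeddedNetwork N E} (H : NetworkHamiltonian Γ)

/-- `a_γ = max_{s ∈ [0,1]} min_p H_γ(s,p)`. -/
def aArc (e : E) : ℝ := ⨆ s : Icc (0 : ℝ) 1, ⨅ p : ℝ, H.toFun e s p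

/-- `c_γ`: the least level at which `H_γ = a` has a periodic subsolution, i.e. a subsolution in `(0,1)`,
continuous on `[0,1]`, with the same value at `0` and `1`. -/
def cArc (e : E) : ℝ :=
  sInf {a | ∃ w : ℝ → ℝ, ContinuousOn w (Icc 0 1) ∧ w 0 = w 1 ∧ IsViscositySubsolution (H.toFun e) a w}

open Classical in
/-- `a₀`: the maximum of the `a_γ` over the non-closed arcs and of the `c_γ` over the closed arcs. -/
def aZero : ℝ := ⨆ e : E, if Γ.arc e 0 = Γ.arc e 1 then H.cArc e else H.aArc e

/-- On each arc with `a_γ = a₀` the function `s ↦ min_p H_γ(s,p)` is constant on `[0,1]`. -/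
def MinConstant : Prop :=
  ∀ e, H.aArc e = H.aZero → ∀ s ∈ Icc (0 : ℝ) 1, ∀ t ∈ Icc (0 : ℝ) 1,
    ⨅ p : ℝ, H.toFun e s p = ⨅ p : ℝ, H.toFun e t p

/-- `u` is a subsolution of `H(x, Du) = a` on the network. -/
def IsSubsolution (a : ℝ) (u : EuclideanSpace ℝ (Fin N) → ℝ) : Prop :=
  Γ.IsContinuous u ∧ ∀ e, IsViscositySubsolution (H.toFun e) a (fun s => u (Γ.arc e s))

/-- `u` is a solution of `H(x, Du) = a` on the network: it is continuous, a viscosity solution in the interior of each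
arc, and at every vertex the state constraint condition holds along at least one arc ending there. -/
def IsSolution (a : ℝ) (u : EuclideanSpace ℝ (Fin N) → ℝ) : Prop :=
  Γ.IsContinuous u ∧
  (∀ e, IsViscositySubsolution (H.toFun e) a (fun s => u (Γ.arc e s)) ∧
    IsViscositySupersolution (H.toFun e) a (fun s => u (Γ.arc e s))) ∧
  ∀ x ∈ Γ.vertices, ∃ e, Γ.terminal e = x ∧
    StateConstraintAtOne (H.toFun e) a (fun s => u (Γ.arc e s))

/-- `w` is the maximal subsolution of `H(x, Du) = a` on the network taking the value `α` at `y`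
(it is unique as a function on the network). -/
def IsMaximalSubsolution (a : ℝ) (y : EuclideanSpace ℝ (Fin N)) (α : ℝ)
    (w : EuclideanSpace ℝ (Fin N) → ℝ) : Prop :=
  (H.IsSubsolution a w ∧ w y = α) ∧
  ∀ u, H.IsSubsolution a u → u y = α → ∀ x ∈ Γ.carrier, u x ≤ w x

/-- `σ_a⁺(s) = max {p | H_γ(s,p) = a}`. -/
def sigmaPlus (a : ℝ) (e : E) (s : ℝ) : ℝ := sSup {p | H.toFun e s p = a}

/-- `σ_a(e) = ∫₀¹ σ_a⁺`. -/
def sigma (a : ℝ) (e : E) : ℝ := ∫ s in (0 : ℝ)..1, H.sigmaPlus a e s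

/-- `σ_a(ξ)`: the sum of `σ_a` over the edges of a path. -/
def sigmaPath (a : ℝ) (ξ : List E) : ℝ := (ξ.map (H.sigma a)).sum

/-- `u`, restricted to the vertices, is a subsolution of the discrete functional equation at level `a`. -/
def IsDiscreteSubsolution (a : ℝ) (u : EuclideanSpace ℝ (Fin N) → ℝ) : Prop :=
  ∀ e, u (Γ.terminal e) ≤ u (Γ.origin e) + H.sigma a e

/-- The critical value: the least `a ≥ a₀` at which the discrete functional equation has a subsolution. -/
def criticalValue : ℝ :=
  sInf {a | H.aZero ≤ a ∧ ∃ u, H.IsDiscreteSubsolution a u}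

/-- The Aubry set of the abstract graph: the edges belonging to some cycle `ξ` with `σ_c(ξ) = 0`. -/
def aubryEdges : Set E :=
  {e | ∃ x ξ, Γ.IsPath x ξ x ∧ e ∈ ξ ∧ H.sigmaPath H.criticalValue ξ = 0}

/-- The Aubry set of the network: the union of the supports of the arcs attached to edges of the Aubry set. -/
def aubrySet : Set (EuclideanSpace ℝ (Fin N)) :=
  {x | ∃ e ∈ H.aubryEdges, ∃ t ∈ Icc (0 : ℝ) 1, x = Γ.arc e t}

end NetworkHamiltonian

end

/-! At a level `a` not below the minima of the Hamiltonians, each sublevel set {p : H(s,p) ≤ a} is a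
compact interval [σ⁻(s), σ⁺(s)], with H < a strictly inside. Hence a continuous function is a
subsolution exactly when its increment along an arc, from s to t, is at most the integral of σ⁺ for
s ≤ t, and that of the reversed arc otherwise. This is domination by `cost`
(`isSubsolution_iff_isDominated`), and the PDE becomes a problem of costs. A dominated function can
be prescribed on any set containing the vertices, as long as it respects the costs there
(`exists_isDominated_extension`). The maximal subsolution is then the pointwise supremum, which is
finite by connectedness; the family is nonempty because cycles have nonnegative cost at the critical
level.

Maximality is used through one principle, `IsMaximalSubsolution.exists_calibrated_step`: on a set R
that misses y, the function w cannot be raised, so some step into R has an increment equal to its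
cost. A segment ending at x along which w increases by the full cost forces the supersolution and
state constraint inequalities at x. With R = {x} this settles every x ≠ y. At y itself such a
segment exists if y is in the Aubry set, since a cycle of zero cost leaves no slack to any
subsolution.

Conversely, let w be a solution. If no segment coming from the far end of an arc were calibrated at
y, then w would equal w(y) plus the cost of leaving y near y
(`IsMaximalSubsolution.calibrated_or_eventually`), and a function with slope (σ⁻+σ⁺)/2, where H < a,
would touch w from below at y (`exists_strict_test_function`). So a calibrated segment enters y. The
principle, applied to the vertices that calibrated chains from y do not reach, shows that there are
none, and such a chain closes the segment into a cycle of zero cost. The constancy of the minima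
gives `MinConstant.dichotomy`: either σ⁻ < σ⁺ on a whole arc, as this argument requires, or σ⁻ = σ⁺
on all of it, and going back and forth is then a cycle of zero cost. -/

/-! ### Level sets of coercive quasiconvex functions of one variable -/

/-- The properties of `p ↦ H_γ(s,p)`. -/
structure IsEikonalProfile (h : ℝ → ℝ) : Prop where
  continuous : Continuous h
  coercive : Tendsto h (cocompact ℝ) atTop
  quasiconvex : QuasiconvexOn ℝ univ h
  interior_sublevel : ∀ a : ℝ, interior {p | h p ≤ a} = {p | h p < a}

namespace IsEikonalProfile

variable {h : ℝ → ℝ}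

lemma tendsto_atTop (hh : IsEikonalProfile h) : Tendsto h atTop atTop :=
  hh.coercive.mono_left (by rw [cocompact_eq_atBot_atTop]; exact le_sup_right)

lemma tendsto_atBot (hh : IsEikonalProfile h) : Tendsto h atBot atTop :=
  hh.coercive.mono_left (by rw [cocompact_eq_atBot_atTop]; exact le_sup_left)

lemma convex_sublevel (hh : IsEikonalProfile h) (a : ℝ) : Convex ℝ {p | h p ≤ a} := by
  simpa using hh.quasiconvex a

lemma le_of_mem_Icc (hh : IsEikonalProfile h) {a p q r : ℝ} (hp : h p ≤ a) (hr : h r ≤ a)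
    (hpq : p ≤ q) (hqr : q ≤ r) : h q ≤ a :=
  (hh.convex_sublevel a).ordConnected.out hp hr ⟨hpq, hqr⟩

/-- The condition on interiors enters here: it excludes plateaus, and it makes the sublevel set at
the minimum a single point. -/
lemma lt_of_mem_Ioo (hh : IsEikonalProfile h) {a p q r : ℝ} (hp : h p ≤ a) (hr : h r ≤ a)
    (hpq : p < q) (hqr : q < r) : h q < a := by
  have : q ∈ interior {p | h p ≤ a} :=
    mem_interior.2 ⟨Ioo p r, fun x hx => hh.le_of_mem_Icc hp hr hx.1.le hx.2.le, isOpen_Ioo,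
      hpq, hqr⟩
  rwa [hh.interior_sublevel] at this

lemma bddAbove_level (hh : IsEikonalProfile h) (a : ℝ) : BddAbove {p | h p = a} := by
  obtain ⟨M, hM⟩ := eventually_atTop.1 (hh.tendsto_atTop.eventually_gt_atTop a)
  exact ⟨M, fun p hp => by_contra fun hc => (hM p (not_le.1 hc).le).ne' hp⟩

lemma exists_ge_level (hh : IsEikonalProfile h) {a p : ℝ} (hp : h p ≤ a) :
    ∃ q, p ≤ q ∧ h q = a := by
  obtain ⟨M, hM1, hM2⟩ :=
    ((hh.tendsto_atTop.eventually_gt_atTop a).and (eventually_ge_atTop p)).exists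
  obtain ⟨q, hq, hq'⟩ := intermediate_value_Icc hM2 hh.continuous.continuousOn ⟨hp, hM1.le⟩
  exact ⟨q, hq.1, hq'⟩

lemma le_sSup_level (hh : IsEikonalProfile h) {a p : ℝ} (hp : h p ≤ a) :
    p ≤ sSup {p | h p = a} := by
  obtain ⟨q, hpq, hq⟩ := hh.exists_ge_level hp
  exact hpq.trans (le_csSup (hh.bddAbove_level a) hq)

lemma apply_sSup_level (hh : IsEikonalProfile h) {a p : ℝ} (hp : h p ≤ a) :
    h (sSup {p | h p = a}) = a := by
  obtain ⟨q, -, hq⟩ := hh.exists_ge_level hp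
  exact (isClosed_eq hh.continuous continuous_const).csSup_mem ⟨q, hq⟩ (hh.bddAbove_level a)

lemma exists_forall_le (hh : IsEikonalProfile h) : ∃ p, ∀ q, h p ≤ h q :=
  hh.continuous.exists_forall_le hh.coercive

lemma bddBelow_range (hh : IsEikonalProfile h) : BddBelow (range h) := by
  obtain ⟨p, hp⟩ := hh.exists_forall_le
  exact ⟨h p, by rintro _ ⟨q, rfl⟩; exact hp q⟩

lemma exists_eq_iInf (hh : IsEikonalProfile h) : ∃ p, h p = ⨅ q, h q := by
  obtain ⟨p, hp⟩ := hh.exists_forall_le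
  exact ⟨p, le_antisymm (le_ciInf hp) (ciInf_le hh.bddBelow_range p)⟩

end IsEikonalProfile

/-! ### Arcs, their reversals and their interior points -/

lemma one_sub_mem_unit {s : ℝ} (hs : s ∈ Icc (0 : ℝ) 1) : 1 - s ∈ Icc (0 : ℝ) 1 :=
  ⟨by linarith [hs.2], by linarith [hs.1]⟩

namespace EmbeddedNetwork

variable {N : ℕ} {E : Type*} (Γ : EmbeddedNetwork N E)

lemma arc_rev_one_sub (e : E) {s : ℝ} (hs : s ∈ Icc (0 : ℝ) 1) :
    Γ.arc (Γ.rev e) (1 - s) = Γ.arc e s := by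
  rw [Γ.arc_rev e _ (one_sub_mem_unit hs), sub_sub_cancel]

lemma terminal_eq (e : E) : Γ.terminal e = Γ.arc e 1 := by
  have := Γ.arc_rev_one_sub e (s := 1) (by simp)
  rw [sub_self] at this
  exact this

lemma origin_rev (e : E) : Γ.origin (Γ.rev e) = Γ.terminal e := rfl

lemma terminal_rev (e : E) : Γ.terminal (Γ.rev e) = Γ.origin e := by
  rw [terminal, Γ.rev_rev]

lemma arc_mem_carrier (e : E) {s : ℝ} (hs : s ∈ Icc (0 : ℝ) 1) : Γ.arc e s ∈ Γ.carrier :=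
  mem_iUnion.2 ⟨e, s, hs, rfl⟩

lemma mem_carrier {x : EuclideanSpace ℝ (Fin N)} :
    x ∈ Γ.carrier ↔ ∃ e, ∃ s ∈ Icc (0 : ℝ) 1, Γ.arc e s = x := by
  simp [carrier]

lemma origin_mem_vertices (e : E) : Γ.origin e ∈ Γ.vertices := ⟨e, rfl⟩

lemma terminal_mem_vertices (e : E) : Γ.terminal e ∈ Γ.vertices := ⟨Γ.rev e, rfl⟩

lemma vertices_subset_carrier : Γ.vertices ⊆ Γ.carrier := by
  rintro _ ⟨e, rfl⟩
  exact Γ.arc_mem_carrier e (by simp)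

lemma eq_zero_or_one_of_mem_vertices {e : E} {s : ℝ} (hs : s ∈ Icc (0 : ℝ) 1)
    (h : Γ.arc e s ∈ Γ.vertices) : s = 0 ∨ s = 1 := by
  by_contra hc
  push Not at hc
  obtain ⟨e', he'⟩ := h
  exact Γ.vertex_notMem_interior e e'
    ⟨s, ⟨lt_of_le_of_ne hs.1 hc.1.symm, lt_of_le_of_ne hs.2 hc.2⟩, he'.symm⟩

/-- Interiors of arcs are disjoint from the vertices and from each other, so an interior point
determines its arc up to orientation. -/
lemma arc_eq_arc_interior {e e' : E} {s t : ℝ} (hs : s ∈ Ioo (0 : ℝ) 1) (ht : t ∈ Icc (0 : ℝ) 1)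
    (h : Γ.arc e s = Γ.arc e' t) : (e' = e ∧ t = s) ∨ (e' = Γ.rev e ∧ t = 1 - s) := by
  have hs' : s ∈ Icc (0 : ℝ) 1 := Ioo_subset_Icc_self hs
  have key : ∀ u ∈ Icc (0 : ℝ) 1, Γ.arc e s = Γ.arc e u → u = s := by
    intro u hu hsu
    rcases lt_trichotomy s u with hlt | heq | hlt
    · exact absurd (Γ.simple e s hs' u hu hlt hsu).1 hs.1.ne'
    · exact heq.symm
    · exact absurd (Γ.simple e u hu s hs' hlt hsu.symm).2 hs.2.ne
  have ht' : t ∈ Ioo (0 : ℝ) 1 := by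
    have hv : Γ.arc e' t ∉ Γ.vertices := fun hv => by
      rcases Γ.eq_zero_or_one_of_mem_vertices hs' (h ▸ hv) with h0 | h0
      · exact hs.1.ne' h0
      · exact hs.2.ne h0
    refine ⟨lt_of_le_of_ne ht.1 ?_, lt_of_le_of_ne ht.2 ?_⟩
    · rintro rfl; exact hv (Γ.origin_mem_vertices e')
    · rintro rfl; exact hv (Γ.terminal_eq e' ▸ Γ.terminal_mem_vertices e')
  by_cases h1 : e' = e
  · subst h1; exact Or.inl ⟨rfl, key t ht h⟩
  by_cases h2 : e' = Γ.rev e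
  · subst h2
    rw [Γ.arc_rev e t ht] at h
    exact Or.inr ⟨rfl, by linarith [key _ (one_sub_mem_unit ht) h]⟩
  · exact (Set.disjoint_left.1 (Γ.disjoint_interiors e' e h1 h2) ⟨t, ht', rfl⟩
      ⟨s, hs, h⟩).elim

end EmbeddedNetwork

/-! ### The extremal slopes at a given level -/

namespace NetworkHamiltonian

variable {N : ℕ} {E : Type*} {Γ : EmbeddedNetwork N E} (H : NetworkHamiltonian Γ)

lemma profile (e : E) {s : ℝ} (hs : s ∈ Icc (0 : ℝ) 1) : IsEikonalProfile (H.toFun e s) where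
  continuous := by
    have : ContinuousOn (fun p : ℝ => H.toFun e (s, p).1 (s, p).2) univ :=
      (H.continuousOn e).comp (f := fun p : ℝ => (s, p)) (by fun_prop) fun p _ => ⟨hs, mem_univ _⟩
    simpa [← continuousOn_univ] using this
  coercive := H.coercive e s hs
  quasiconvex := H.quasiconvex e s hs
  interior_sublevel := H.interior_sublevel e s hs

lemma continuousOn_left (e : E) (p : ℝ) : ContinuousOn (fun s => H.toFun e s p) (Icc 0 1) :=
  (H.continuousOn e).comp (f := fun s : ℝ => (s, p)) (by fun_prop) fun s hs => ⟨hs, mem_univ _⟩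

/-- The level `a` is at least `min_p H_γ(s,p)` for all arcs `γ` and all `s`. -/
def Admissible (a : ℝ) : Prop := ∀ e, ∀ s ∈ Icc (0 : ℝ) 1, ∃ p, H.toFun e s p ≤ a

/-- `min {p | H_γ(s,p) = a}`, obtained from the reversed arc. -/
noncomputable def sigmaMinus (a : ℝ) (e : E) (s : ℝ) : ℝ := -H.sigmaPlus a (Γ.rev e) (1 - s)

variable {H} {a : ℝ}

lemma Admissible.mono (ha : H.Admissible a) {b : ℝ} (hab : a ≤ b) : H.Admissible b :=
  fun e s hs => (ha e s hs).imp fun _ hp => hp.trans hab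

section

variable (ha : H.Admissible a) (e : E) {s : ℝ} (hs : s ∈ Icc (0 : ℝ) 1)
include ha hs

lemma apply_sigmaPlus : H.toFun e s (H.sigmaPlus a e s) = a := by
  obtain ⟨p, hp⟩ := ha e s hs
  exact (H.profile e hs).apply_sSup_level hp

lemma apply_sigmaMinus : H.toFun e s (H.sigmaMinus a e s) = a := by
  have h1 := apply_sigmaPlus ha (Γ.rev e) (one_sub_mem_unit hs)
  rwa [H.rev_eq e _ (one_sub_mem_unit hs), sub_sub_cancel] at h1

omit ha in
lemma le_sigmaPlus {p : ℝ} (hp : H.toFun e s p ≤ a) : p ≤ H.sigmaPlus a e s :=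
  (H.profile e hs).le_sSup_level hp

omit ha in
lemma sigmaMinus_le {p : ℝ} (hp : H.toFun e s p ≤ a) : H.sigmaMinus a e s ≤ p := by
  have h1 : H.toFun (Γ.rev e) (1 - s) (-p) ≤ a := by
    rwa [H.rev_eq e _ (one_sub_mem_unit hs), sub_sub_cancel, neg_neg]
  have := le_sigmaPlus (Γ.rev e) (one_sub_mem_unit hs) h1
  unfold sigmaMinus
  linarith

lemma sigmaMinus_le_sigmaPlus : H.sigmaMinus a e s ≤ H.sigmaPlus a e s :=
  sigmaMinus_le e hs (apply_sigmaPlus ha e hs).le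

lemma apply_le_of_mem {p : ℝ} (h1 : H.sigmaMinus a e s ≤ p) (h2 : p ≤ H.sigmaPlus a e s) :
    H.toFun e s p ≤ a :=
  (H.profile e hs).le_of_mem_Icc (apply_sigmaMinus ha e hs).le (apply_sigmaPlus ha e hs).le h1 h2

lemma apply_lt_of_mem {p : ℝ} (h1 : H.sigmaMinus a e s < p) (h2 : p < H.sigmaPlus a e s) :
    H.toFun e s p < a :=
  (H.profile e hs).lt_of_mem_Ioo (apply_sigmaMinus ha e hs).le (apply_sigmaPlus ha e hs).le h1 h2

omit ha in
lemma lt_apply_of_sigmaPlus_lt {p : ℝ} (hp : H.sigmaPlus a e s < p) : a < H.toFun e s p := by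
  by_contra hc
  exact absurd (le_sigmaPlus e hs (not_lt.1 hc)) (not_le.2 hp)

lemma le_apply_of_sigmaPlus_le {p : ℝ} (hp : H.sigmaPlus a e s ≤ p) : a ≤ H.toFun e s p := by
  rcases hp.eq_or_lt with rfl | hp
  · exact (apply_sigmaPlus ha e hs).ge
  · exact (lt_apply_of_sigmaPlus_lt e hs hp).le

end

/-- If the largest slope at t were at least b, quasiconvexity between `σ⁺(s)` and `σ⁺(t)` would
bound H(t,b) by the larger of a and H(t,σ⁺(s)); near s both are smaller than H(t,b). -/
lemma sigmaPlus_upper (ha : H.Admissible a) (e : E) {s : ℝ} (hs : s ∈ Icc (0 : ℝ) 1) {b : ℝ}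
    (hb : H.sigmaPlus a e s < b) : ∀ᶠ t in 𝓝[Icc 0 1] s, H.sigmaPlus a e t < b := by
  have h1 : a < H.toFun e s b := lt_apply_of_sigmaPlus_lt e hs hb
  have hc := H.continuousOn_left e
  have e1 := (hc b s hs).eventually (lt_mem_nhds h1)
  have e2 := (hc (H.sigmaPlus a e s) s hs).eventually_lt (hc b s hs)
    (by simpa only [apply_sigmaPlus ha e hs] using h1)
  filter_upwards [e1, e2, self_mem_nhdsWithin] with t h1 h2 ht
  by_contra hcon
  exact absurd ((H.profile e ht).le_of_mem_Icc (le_max_left _ (H.toFun e t (H.sigmaPlus a e t)))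
    (le_max_right _ _) hb.le (not_lt.1 hcon)) (not_le.2 (max_lt h2 (by
      rw [apply_sigmaPlus ha e ht]; exact h1)))

lemma tendsto_one_sub (s : ℝ) : Tendsto (fun t : ℝ => 1 - t) (𝓝[Icc 0 1] s)
    (𝓝[Icc 0 1] (1 - s)) :=
  tendsto_nhdsWithin_of_tendsto_nhds_of_eventually_within _
    ((continuous_const.sub continuous_id).continuousAt.mono_left nhdsWithin_le_nhds)
    (eventually_nhdsWithin_of_forall fun _ ht => one_sub_mem_unit ht)

lemma continuousOn_sigmaPlus (ha : H.Admissible a) (e : E) :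
    ContinuousOn (H.sigmaPlus a e) (Icc 0 1) := by
  intro s hs
  refine tendsto_order.2 ⟨fun b hb => ?_, fun b hb => sigmaPlus_upper ha e hs hb⟩
  -- Lower semicontinuity: at a degenerate point it comes from `σ⁻ ≤ σ⁺` and the upper estimate on
  -- the reversed arc; otherwise a slope p with H(s,p) < a stays admissible nearby.
  rcases (sigmaMinus_le_sigmaPlus ha e hs).eq_or_lt with heq | hlt
  · have h1 := (tendsto_one_sub s).eventually
      (sigmaPlus_upper ha (Γ.rev e) (one_sub_mem_unit hs) (b := -b) (by
        have : H.sigmaMinus a e s = -H.sigmaPlus a (Γ.rev e) (1 - s) := rfl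
        linarith))
    filter_upwards [h1, self_mem_nhdsWithin] with t ht ht'
    have := sigmaMinus_le_sigmaPlus ha e ht'
    unfold sigmaMinus at this
    linarith
  · obtain ⟨p, hp1, hp2⟩ := exists_between (max_lt hlt hb)
    have h1 := apply_lt_of_mem ha e hs ((le_max_left _ _).trans_lt hp1) hp2
    filter_upwards [(H.continuousOn_left e p s hs).eventually (gt_mem_nhds h1),
      self_mem_nhdsWithin] with t ht ht'
    exact ((le_max_right _ _).trans_lt hp1).trans_le (le_sigmaPlus e ht' ht.le)

end NetworkHamiltonian

namespace NetworkHamiltonian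

variable {N : ℕ} {E : Type*} {Γ : EmbeddedNetwork N E} (H : NetworkHamiltonian Γ)

/-! ### The cost of moving along an arc -/

/-- `σ_a⁺` extended to `ℝ` by constants. -/
noncomputable def slope (a : ℝ) (e : E) : ℝ → ℝ :=
  IccExtend (zero_le_one (α := ℝ)) fun s => H.sigmaPlus a e s

/-- A primitive of `σ_a⁺`. -/
noncomputable def primitive (a : ℝ) (e : E) (r : ℝ) : ℝ := ∫ s in (0 : ℝ)..r, H.slope a e s

/-- The largest possible increment of a subsolution between the parameters `s` and `t` of an arc. -/
noncomputable def cost (a : ℝ) (e : E) (s t : ℝ) : ℝ :=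
  if s ≤ t then H.primitive a e t - H.primitive a e s
  else H.primitive a (Γ.rev e) (1 - t) - H.primitive a (Γ.rev e) (1 - s)

/-- `u` increases along the arcs by at most the cost. -/
def IsDominated (a : ℝ) (u : EuclideanSpace ℝ (Fin N) → ℝ) : Prop :=
  ∀ e, ∀ s ∈ Icc (0 : ℝ) 1, ∀ t ∈ Icc (0 : ℝ) 1,
    u (Γ.arc e t) ≤ u (Γ.arc e s) + H.cost a e s t

variable {H} {a : ℝ}

lemma slope_eq (e : E) {s : ℝ} (hs : s ∈ Icc (0 : ℝ) 1) : H.slope a e s = H.sigmaPlus a e s :=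
  IccExtend_of_mem _ _ hs

lemma continuous_slope (ha : H.Admissible a) (e : E) : Continuous (H.slope a e) :=
  (continuousOn_iff_continuous_domRestrict.1 (continuousOn_sigmaPlus ha e)).Icc_extend'

lemma hasDerivAt_primitive (ha : H.Admissible a) (e : E) (r : ℝ) :
    HasDerivAt (H.primitive a e) (H.slope a e r) r :=
  (continuous_slope ha e).integral_hasStrictDerivAt 0 r |>.hasDerivAt

lemma contDiff_primitive (ha : H.Admissible a) (e : E) : ContDiff ℝ 1 (H.primitive a e) := by
  refine contDiff_one_iff_deriv.2 ⟨fun r => (hasDerivAt_primitive ha e r).differentiableAt, ?_⟩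
  rw [show deriv (H.primitive a e) = H.slope a e from
    funext fun r => (hasDerivAt_primitive ha e r).deriv]
  exact continuous_slope ha e

lemma continuous_primitive (ha : H.Admissible a) (e : E) : Continuous (H.primitive a e) :=
  (contDiff_primitive ha e).continuous

lemma hasDerivAt_primitive_rev (ha : H.Admissible a) (e : E) {r : ℝ} (hr : r ∈ Icc (0 : ℝ) 1) :
    HasDerivAt (fun s => H.primitive a (Γ.rev e) (1 - s)) (H.sigmaMinus a e r) r := by
  have := (hasDerivAt_primitive ha (Γ.rev e) (1 - r)).comp_const_sub 1 r
  rwa [slope_eq _ (one_sub_mem_unit hr)] at this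

@[simp] lemma primitive_zero (e : E) : H.primitive a e 0 = 0 := by simp [primitive]

lemma primitive_one (e : E) : H.primitive a e 1 = H.sigma a e := by
  unfold primitive sigma
  refine intervalIntegral.integral_congr fun s hs => ?_
  rw [uIcc_of_le zero_le_one] at hs
  exact slope_eq e hs

lemma cost_of_le {e : E} {s t : ℝ} (h : s ≤ t) :
    H.cost a e s t = H.primitive a e t - H.primitive a e s := if_pos h

lemma cost_of_ge {e : E} {s t : ℝ} (h : t ≤ s) : H.cost a e s t =
    H.primitive a (Γ.rev e) (1 - t) - H.primitive a (Γ.rev e) (1 - s) := by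
  rcases h.eq_or_lt with rfl | h
  · simp [cost]
  · exact if_neg (not_le.2 h)

@[simp] lemma cost_self (e : E) (s : ℝ) : H.cost a e s s = 0 := by simp [cost]

lemma cost_rev (e : E) (s t : ℝ) : H.cost a (Γ.rev e) (1 - s) (1 - t) = H.cost a e s t := by
  rcases le_total s t with h | h
  · rw [cost_of_ge (by linarith), cost_of_le h, Γ.rev_rev, sub_sub_cancel, sub_sub_cancel]
  · rw [cost_of_le (by linarith), cost_of_ge h]

lemma cost_zero_one (e : E) : H.cost a e 0 1 = H.sigma a e := by
  rw [cost_of_le zero_le_one, primitive_one, primitive_zero, sub_zero]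

lemma cost_one_zero (e : E) : H.cost a e 1 0 = H.sigma a (Γ.rev e) := by
  rw [← cost_rev, sub_self, sub_zero, cost_zero_one]

/-- The derivative is σ⁺ − σ⁻ ≥ 0. It measures what is lost in going back and forth, and it yields
the triangle inequality for `cost`. -/
lemma monotoneOn_sub_primitive_rev (ha : H.Admissible a) (e : E) :
    MonotoneOn (fun s => H.primitive a e s - H.primitive a (Γ.rev e) (1 - s)) (Icc 0 1) := by
  have hd : ∀ s ∈ Icc (0 : ℝ) 1, HasDerivAt
      (fun s => H.primitive a e s - H.primitive a (Γ.rev e) (1 - s))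
      (H.slope a e s - H.sigmaMinus a e s) s := fun s hs =>
    (hasDerivAt_primitive ha e s).sub (hasDerivAt_primitive_rev ha e hs)
  refine monotoneOn_of_deriv_nonneg (convex_Icc _ _)
    (fun s hs => (hd s hs).continuousAt.continuousWithinAt)
    (fun s hs => (hd s (interior_subset hs)).differentiableAt.differentiableWithinAt) fun s hs => ?_
  have hs' := interior_subset hs
  rw [(hd s hs').deriv, slope_eq e hs', sub_nonneg]
  exact sigmaMinus_le_sigmaPlus ha e hs'

lemma cost_triangle (ha : H.Admissible a) (e : E) {r s t : ℝ} (hr : r ∈ Icc (0 : ℝ) 1)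
    (hs : s ∈ Icc (0 : ℝ) 1) (ht : t ∈ Icc (0 : ℝ) 1) :
    H.cost a e r t ≤ H.cost a e r s + H.cost a e s t := by
  have m := monotoneOn_sub_primitive_rev ha e
  have m1 := @m r hr s hs
  have m2 := @m s hs t ht
  have m3 := @m s hs r hr
  have m4 := @m t ht s hs
  simp only at m1 m2 m3 m4
  unfold cost
  split_ifs with h1 h2 h3 h3 h2 h3 h3 <;>
  first
  | linarith
  | linarith [m1 (by linarith)]
  | linarith [m2 (by linarith)]
  | linarith [m3 (by linarith)]
  | linarith [m4 (by linarith)]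

lemma continuous_cost_right (ha : H.Admissible a) (e : E) (s : ℝ) :
    Continuous (fun t => H.cost a e s t) := by
  unfold cost
  have h1 := continuous_primitive ha e
  have h2 := continuous_primitive ha (Γ.rev e)
  refine Continuous.if_le (by fun_prop) (by fun_prop) continuous_const continuous_id ?_
  rintro t rfl
  simp

lemma continuous_cost_left (ha : H.Admissible a) (e : E) (t : ℝ) :
    Continuous (fun s => H.cost a e s t) := by
  unfold cost
  have h1 := continuous_primitive ha e
  have h2 := continuous_primitive ha (Γ.rev e)
  refine Continuous.if_le (by fun_prop) (by fun_prop) continuous_id continuous_const ?_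
  rintro s rfl
  simp

/-! ### One-sided comparison of derivatives -/

lemma deriv_le_of_touching_left {f g : ℝ → ℝ} {f' g' r : ℝ} (hf : HasDerivAt f f' r)
    (hg : HasDerivAt g g' r) (h : f r = g r) (hle : ∀ᶠ s in 𝓝[<] r, f s ≤ g s) : g' ≤ f' := by
  have h1 := ((hasDerivAt_iff_tendsto_slope.1 (hf.sub hg)).mono_left
    (nhdsWithin_mono r fun x (hx : x ∈ Iio r) => (mem_Iio.1 hx).ne))
  have h2 : 0 ≤ f' - g' := by
    refine ge_of_tendsto h1 ?_
    filter_upwards [hle, self_mem_nhdsWithin] with s hs hs'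
    rw [slope_def_field]
    exact div_nonneg_of_nonpos (by simp only [Pi.sub_apply]; linarith) (by
      simp only [mem_Iio] at hs'; linarith)
  linarith

lemma deriv_le_of_touching_right {f g : ℝ → ℝ} {f' g' r : ℝ} (hf : HasDerivAt f f' r)
    (hg : HasDerivAt g g' r) (h : f r = g r) (hle : ∀ᶠ s in 𝓝[>] r, f s ≤ g s) : f' ≤ g' := by
  have h1 := ((hasDerivAt_iff_tendsto_slope.1 (hg.sub hf)).mono_left
    (nhdsWithin_mono r fun x (hx : x ∈ Ioi r) => (mem_Ioi.1 hx).ne'))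
  have h2 : 0 ≤ g' - f' := by
    refine ge_of_tendsto h1 ?_
    filter_upwards [hle, self_mem_nhdsWithin] with s hs hs'
    rw [slope_def_field]
    exact div_nonneg (by simp only [Pi.sub_apply]; linarith) (by
      simp only [mem_Ioi] at hs'; linarith)
  linarith

lemma eventually_left_of_window {r δ : ℝ} (hδ : 0 < δ) (hr : r ∈ Ioc (0 : ℝ) 1) :
    ∀ᶠ t in 𝓝[<] r, t ∈ Ioo (r - δ) r ∩ Ioo 0 1 := by
  filter_upwards [Ioo_mem_nhdsLT (show max (r - δ) 0 < r from max_lt (by linarith) hr.1)] with t ht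
  have := max_lt_iff.1 ht.1
  exact ⟨⟨this.1, ht.2⟩, this.2, ht.2.trans_le hr.2⟩

lemma eventually_right_of_window {r δ : ℝ} (hδ : 0 < δ) (hr : r ∈ Ico (0 : ℝ) 1) :
    ∀ᶠ t in 𝓝[>] r, t ∈ Ioo r (r + δ) ∩ Ioo 0 1 := by
  filter_upwards [Ioo_mem_nhdsGT (show r < min (r + δ) 1 from lt_min (by linarith) hr.2)] with t ht
  have := lt_min_iff.1 ht.2
  exact ⟨⟨ht.1, this.1⟩, hr.1.trans_lt ht.1, this.2⟩

/-! ### Subsolutions are the dominated functions -/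

/-- If the increment were too large, the primitive of σ⁺ plus a small increasing exponential would
touch w from above at an interior point, with slope larger than σ⁺. No differentiability of w is
needed. -/
lemma increment_le_of_subsolution (ha : H.Admissible a) (e : E) {w : ℝ → ℝ}
    (hc : ContinuousOn w (Icc 0 1)) (hw : IsViscositySubsolution (H.toFun e) a w) {s t : ℝ}
    (hs : 0 ≤ s) (hst : s ≤ t) (ht : t < 1) :
    w t ≤ w s + (H.primitive a e t - H.primitive a e s) := by
  set P := H.primitive a e with hP
  have hPc : Continuous P := continuous_primitive ha e
  by_contra hcon
  push Not at hcon
  have hne : s < t := lt_of_le_of_ne hst fun h => by subst h; simp at hcon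
  set δ := (w t - w s - (P t - P s)) / 2 with hδ
  have hδ0 : 0 < δ := by rw [hδ]; linarith
  obtain ⟨t', htt', ht'1⟩ := exists_between ht
  -- The exponential equals 1 at t; its rate k is taken so large that w − ψ is smaller at t' than at
  -- t. At s the excess 2δ already gives this, so the maximum over [s,t'] is interior.
  obtain ⟨k, hk0, hk⟩ : ∃ k : ℝ, 0 < k ∧
      w t' - w t - (P t' - P t) < δ * (Real.exp (k * (t' - t)) - 1) := by
    have h1 : Tendsto (fun k : ℝ => δ * (Real.exp (k * (t' - t)) - 1)) atTop atTop := by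
      refine Tendsto.const_mul_atTop hδ0 (tendsto_atTop_add_const_right _ _ ?_)
      exact Real.tendsto_exp_atTop.comp (tendsto_id.atTop_mul_const (by linarith))
    exact ((eventually_gt_atTop 0).and (h1.eventually_gt_atTop _)).exists
  set ψ : ℝ → ℝ := fun r => P r + δ * Real.exp (k * (r - t)) with hψ
  have hsub : Icc s t' ⊆ Icc 0 1 := Icc_subset_Icc hs ht'1.le
  obtain ⟨r, hr, hmax⟩ := isCompact_Icc.exists_isMaxOn (s := Icc s t')
    ⟨t, hst, htt'.le⟩ (f := fun r => w r - ψ r)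
    ((hc.mono hsub).sub (by rw [hψ]; fun_prop))
  have hmt : w t - ψ t ≤ w r - ψ r := hmax ⟨hst, htt'.le⟩
  have hψt : ψ t = P t + δ := by simp [hψ]
  have hrs : r ≠ s := by
    rintro rfl
    have h1 : 0 < δ * Real.exp (k * (r - t)) := by positivity
    have h2 : ψ r = P r + δ * Real.exp (k * (r - t)) := rfl
    linarith
  have hrt : r ≠ t' := by
    rintro rfl
    have h2 : ψ r = P r + δ * Real.exp (k * (r - t)) := rfl
    linarith
  have hr1 : s < r := lt_of_le_of_ne hr.1 hrs.symm
  have hr2 : r < t' := lt_of_le_of_ne hr.2 hrt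
  have hr01 : r ∈ Ioo (0 : ℝ) 1 := ⟨hs.trans_lt hr1, hr2.trans ht'1⟩
  have hderiv : HasDerivAt (fun x => ψ x + (w r - ψ r))
      (H.slope a e r + δ * (Real.exp (k * (r - t)) * (k * 1))) r := by
    refine ((hasDerivAt_primitive ha e r).add (HasDerivAt.const_mul δ ?_)).add_const _
    exact (((hasDerivAt_id r).sub_const t).const_mul k).exp
  have hcd : ContDiff ℝ 1 (fun x => ψ x + (w r - ψ r)) := by
    refine ((contDiff_primitive ha e).add ?_).add contDiff_const
    fun_prop
  have key := hw r hr01 _ hcd (by ring) ⟨min (r - s) (t' - r), lt_min (by linarith) (by linarith),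
    fun x hx => by
      have h1 := hx.1.1
      have h2 := hx.1.2
      have h3 := min_le_left (r - s) (t' - r)
      have h4 := min_le_right (r - s) (t' - r)
      have : w x - ψ x ≤ w r - ψ r := hmax ⟨by linarith, by linarith⟩
      linarith⟩
  rw [hderiv.deriv, slope_eq e (Ioo_subset_Icc_self hr01)] at key
  have h5 : 0 < δ * (Real.exp (k * (r - t)) * (k * 1)) := by positivity
  exact absurd key (not_le.2 (lt_apply_of_sigmaPlus_lt e (Ioo_subset_Icc_self hr01) (by linarith)))

lemma increment_le_cost_of_subsolution (ha : H.Admissible a) (e : E) {w : ℝ → ℝ}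
    (hc : ContinuousOn w (Icc 0 1)) (hw : IsViscositySubsolution (H.toFun e) a w) {s t : ℝ}
    (hs : 0 ≤ s) (hst : s ≤ t) (ht : t ≤ 1) :
    w t ≤ w s + H.cost a e s t := by
  rcases hst.eq_or_lt with rfl | hst
  · simp
  rw [cost_of_le hst.le]
  have hcl : ∀ᶠ x in 𝓝[<] t, w x ≤ w s + (H.primitive a e x - H.primitive a e s) := by
    filter_upwards [Ioo_mem_nhdsLT hst] with x hx
    exact increment_le_of_subsolution ha e hc hw hs hx.1.le (hx.2.trans_le ht)
  have h1 : Tendsto w (𝓝[<] t) (𝓝 (w t)) :=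
    (hc t ⟨hs.trans hst.le, ht⟩).mono_left (nhdsWithin_le_of_mem
      (mem_of_superset (Ioo_mem_nhdsLT hst) fun x hx => ⟨hs.trans hx.1.le, hx.2.le.trans ht⟩))
  refine le_of_tendsto_of_tendsto h1 (Tendsto.mono_left (Continuous.tendsto ?_ t)
    nhdsWithin_le_nhds) hcl
  have := continuous_primitive ha e
  fun_prop

lemma IsDominated.continuousOn (ha : H.Admissible a) {u : EuclideanSpace ℝ (Fin N) → ℝ}
    (hu : H.IsDominated a u) (e : E) : ContinuousOn (fun s => u (Γ.arc e s)) (Icc 0 1) := by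
  intro s hs
  have h1 : Tendsto (fun t => u (Γ.arc e s) + H.cost a e s t) (𝓝[Icc 0 1] s)
      (𝓝 (u (Γ.arc e s))) := by
    have := ((continuous_cost_right ha e s).const_add (u (Γ.arc e s))).tendsto s
    rw [cost_self, add_zero] at this
    exact this.mono_left nhdsWithin_le_nhds
  have h2 : Tendsto (fun t => u (Γ.arc e s) - H.cost a e t s) (𝓝[Icc 0 1] s)
      (𝓝 (u (Γ.arc e s))) := by
    have hcont : Continuous fun t => u (Γ.arc e s) - H.cost a e t s :=
      continuous_const.sub (continuous_cost_left ha e s)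
    have := hcont.tendsto s
    rw [cost_self, sub_zero] at this
    exact this.mono_left nhdsWithin_le_nhds
  refine tendsto_of_tendsto_of_tendsto_of_le_of_le' h2 h1 ?_ ?_
  · filter_upwards [self_mem_nhdsWithin] with t ht
    linarith [hu e t ht s hs]
  · filter_upwards [self_mem_nhdsWithin] with t ht
    exact hu e s hs t ht

/-- A function touching u from above has slope at most σ⁺ by comparison on the left, and at least σ⁻
by comparison on the right. -/
lemma IsDominated.viscositySubsolution (ha : H.Admissible a) {u : EuclideanSpace ℝ (Fin N) → ℝ}
    (hu : H.IsDominated a u) (e : E) :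
    IsViscositySubsolution (H.toFun e) a (fun s => u (Γ.arc e s)) := by
  intro s hs φ hφ hφs ⟨δ, hδ, hle⟩
  have hs' := Ioo_subset_Icc_self hs
  have hd : HasDerivAt φ (deriv φ s) s := (hφ.differentiable one_ne_zero s).hasDerivAt
  refine apply_le_of_mem ha e hs' ?_ ?_
  · refine deriv_le_of_touching_right ((hasDerivAt_primitive_rev ha e hs').add_const
      (φ s - H.primitive a (Γ.rev e) (1 - s))) hd (by ring) ?_
    filter_upwards [eventually_right_of_window hδ ⟨hs.1.le, hs.2⟩] with t ht
    have h1 := hle t ⟨⟨by linarith [ht.1.1], ht.1.2⟩, ht.2⟩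
    have h2 := hu e t (Ioo_subset_Icc_self ht.2) s hs'
    rw [cost_of_ge ht.1.1.le] at h2
    simp only at hφs h1
    linarith
  · rw [← slope_eq e hs']
    refine deriv_le_of_touching_left ((hasDerivAt_primitive ha e s).add_const
      (φ s - H.primitive a e s)) hd (by ring) ?_
    filter_upwards [eventually_left_of_window hδ ⟨hs.1, hs.2.le⟩] with t ht
    have h1 := hle t ⟨⟨ht.1.1, by linarith [ht.1.2]⟩, ht.2⟩
    have h2 := hu e t (Ioo_subset_Icc_self ht.2) s hs'
    rw [cost_of_le ht.1.2.le] at h2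
    simp only at hφs h1
    linarith

end NetworkHamiltonian

namespace EmbeddedNetwork

variable {N : ℕ} {E : Type*} (Γ : EmbeddedNetwork N E)

/-! ### Continuity on the network -/

lemma edist_le_geodesicDist (x y : EuclideanSpace ℝ (Fin N)) : edist x y ≤ Γ.geodesicDist x y := by
  refine le_iInf fun η => le_iInf fun ⟨_, _, h0, h1⟩ => ?_
  rw [← h0, ← h1]
  exact eVariationOn.edist_le η (by simp) (by simp)

lemma continuousOn_arc (e : E) : ContinuousOn (Γ.arc e) (Icc 0 1) :=
  (Γ.contDiffOn_arc e).continuousOn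

lemma exists_lipschitzOnWith_arc (e : E) : ∃ L, LipschitzOnWith L (Γ.arc e) (Icc 0 1) := by
  have := (Γ.contDiffOn_arc e).exists_lipschitzOnWith one_ne_zero (convex_Icc 0 1) isCompact_Icc
  exact this

/-- The arc itself, reparametrized affinely between s and t, is a competitor in the infimum. -/
lemma geodesicDist_arc_le {e : E} {L : NNReal} (hL : LipschitzOnWith L (Γ.arc e) (Icc 0 1))
    {s t : ℝ} (hs : s ∈ Icc (0 : ℝ) 1) (ht : t ∈ Icc (0 : ℝ) 1) :
    Γ.geodesicDist (Γ.arc e s) (Γ.arc e t) ≤ L * edist s t := by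
  set g : ℝ → ℝ := fun r => AffineMap.lineMap s t r with hg
  have hmaps : MapsTo g (Icc 0 1) (Icc 0 1) := fun r hr =>
    (convex_Icc (0 : ℝ) 1).lineMap_mem hs ht hr
  have hgc : Continuous g := AffineMap.lineMap_continuous
  have hglip : LipschitzWith (nndist s t) g := lipschitzWith_lineMap s t
  have hvar : eVariationOn g (Icc 0 1) ≤ edist s t := by
    have h1 := (hglip.lipschitzOnWith (s := univ)).comp_eVariationOn_le (g := id)
      (s := Icc (0 : ℝ) 1) (mapsTo_univ _ _)
    have h2 : eVariationOn (id : ℝ → ℝ) (Icc 0 1) ≤ 1 := by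
      have := (monotone_id (α := ℝ)).monotoneOn (Icc 0 1) |>.eVariationOn_eq
        (a := 0) (b := 1) (by simp) (by simp)
      rw [inter_self] at this
      simp [this]
    calc eVariationOn g (Icc 0 1) ≤ nndist s t * eVariationOn (id : ℝ → ℝ) (Icc 0 1) := h1
      _ ≤ nndist s t * 1 := by gcongr
      _ = edist s t := by rw [mul_one, edist_nndist]
  refine (iInf₂_le (Γ.arc e ∘ g) ⟨(Γ.continuousOn_arc e).comp hgc.continuousOn hmaps,
    fun r hr => Γ.arc_mem_carrier e (hmaps hr), by simp [hg], by simp [hg]⟩).trans ?_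
  exact (hL.comp_eVariationOn_le hmaps).trans (by gcongr)

lemma IsContinuous.continuousOn_comp_arc {u : EuclideanSpace ℝ (Fin N) → ℝ}
    (hu : Γ.IsContinuous u) (e : E) : ContinuousOn (fun s => u (Γ.arc e s)) (Icc 0 1) := by
  obtain ⟨L, hL⟩ := Γ.exists_lipschitzOnWith_arc e
  intro s hs
  refine Metric.tendsto_nhds.2 fun ε hε => ?_
  obtain ⟨δ, hδ, h⟩ := hu _ (Γ.arc_mem_carrier e hs) ε hε
  have h1 : Tendsto (fun t : ℝ => (L : ℝ≥0∞) * edist s t) (𝓝[Icc 0 1] s) (𝓝 0) := by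
    have h2 : Tendsto (fun t : ℝ => edist s t) (𝓝[Icc 0 1] s) (𝓝 0) := by
      have : Continuous fun t : ℝ => edist s t := by fun_prop
      simpa using (this.tendsto s).mono_left nhdsWithin_le_nhds
    simpa using ENNReal.Tendsto.const_mul h2 (Or.inr ENNReal.coe_ne_top)
  filter_upwards [h1.eventually (gt_mem_nhds hδ), self_mem_nhdsWithin] with t ht ht'
  exact h _ (Γ.arc_mem_carrier e ht') ((Γ.geodesicDist_arc_le hL hs ht').trans_lt ht)

/-- Preimages of closed sets are finite unions of compact images, so u is continuous for the
Euclidean distance, which the geodesic distance dominates. -/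
lemma isContinuous_of_continuousOn_comp_arc [Finite E] {u : EuclideanSpace ℝ (Fin N) → ℝ}
    (hu : ∀ e, ContinuousOn (fun s => u (Γ.arc e s)) (Icc 0 1)) : Γ.IsContinuous u := by
  have hcont : ContinuousOn u Γ.carrier := by
    refine continuousOn_iff_isClosed.2 fun t ht => ?_
    refine ⟨⋃ e, Γ.arc e '' (Icc 0 1 ∩ (fun s => u (Γ.arc e s)) ⁻¹' t), ?_, ?_⟩
    · refine isClosed_iUnion_of_finite fun e => IsCompact.isClosed ?_
      exact (isCompact_Icc.of_isClosed_subset ((hu e).preimage_isClosed_of_isClosed isClosed_Icc ht)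
        inter_subset_left).image_of_continuousOn ((Γ.continuousOn_arc e).mono inter_subset_left)
    · ext x
      constructor
      · rintro ⟨hx, hxc⟩
        obtain ⟨e, s, hs, rfl⟩ := Γ.mem_carrier.1 hxc
        exact ⟨mem_iUnion.2 ⟨e, s, ⟨hs, hx⟩, rfl⟩, hxc⟩
      · rintro ⟨hx, hxc⟩
        obtain ⟨e, s, ⟨-, hs⟩, rfl⟩ := mem_iUnion.1 hx
        exact ⟨hs, hxc⟩
  intro x hx ε hε
  obtain ⟨δ, hδ, h⟩ := Metric.nhdsWithin_basis_eball.mem_iff.1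
    (hcont x hx (Metric.ball_mem_nhds _ hε))
  refine ⟨δ, hδ, fun z hz hxz => ?_⟩
  have := h (a := z) ⟨by
    rw [Metric.mem_eball, edist_comm]; exact (Γ.edist_le_geodesicDist x z).trans_lt hxz, hz⟩
  exact this

/-! ### Gluing functions defined on the arcs -/

lemma exists_glued {f : E → ℝ → ℝ} {v : EuclideanSpace ℝ (Fin N) → ℝ}
    (hf0 : ∀ e, f e 0 = v (Γ.origin e))
    (hrev : ∀ e, ∀ s ∈ Icc (0 : ℝ) 1, f (Γ.rev e) s = f e (1 - s)) :
    ∃ u : EuclideanSpace ℝ (Fin N) → ℝ, ∀ e, ∀ s ∈ Icc (0 : ℝ) 1, u (Γ.arc e s) = f e s := by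
  have hv : ∀ e, ∀ s ∈ Icc (0 : ℝ) 1, Γ.arc e s ∈ Γ.vertices → f e s = v (Γ.arc e s) := by
    intro e s hs h
    rcases Γ.eq_zero_or_one_of_mem_vertices hs h with rfl | rfl
    · exact hf0 e
    · have := hrev e 0 (by simp)
      rw [sub_zero] at this
      rw [← this, hf0, origin_rev, terminal_eq]
  have hwd : ∀ e, ∀ s ∈ Icc (0 : ℝ) 1, ∀ e', ∀ t ∈ Icc (0 : ℝ) 1, Γ.arc e s = Γ.arc e' t →
      f e s = f e' t := by
    intro e s hs e' t ht h
    by_cases hx : Γ.arc e s ∈ Γ.vertices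
    · rw [hv e s hs hx, hv e' t ht (h ▸ hx), h]
    · have hs' : s ∈ Ioo (0 : ℝ) 1 := by
        refine ⟨lt_of_le_of_ne hs.1 ?_, lt_of_le_of_ne hs.2 ?_⟩
        · rintro rfl; exact hx (Γ.origin_mem_vertices e)
        · rintro rfl; exact hx (Γ.terminal_eq e ▸ Γ.terminal_mem_vertices e)
      rcases Γ.arc_eq_arc_interior hs' ht h with ⟨rfl, rfl⟩ | ⟨rfl, rfl⟩
      · rfl
      · rw [hrev e _ ht, sub_sub_cancel]
  classical
  refine ⟨fun x => if h : ∃ e, ∃ s ∈ Icc (0 : ℝ) 1, Γ.arc e s = x then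
    f h.choose h.choose_spec.choose else 0, fun e s hs => ?_⟩
  have h : ∃ e', ∃ s' ∈ Icc (0 : ℝ) 1, Γ.arc e' s' = Γ.arc e s := ⟨e, s, hs, rfl⟩
  simp only [dif_pos h]
  exact hwd _ _ h.choose_spec.choose_spec.1 e s hs h.choose_spec.choose_spec.2

end EmbeddedNetwork

/-! ### Subsolutions on the network as dominated functions -/

namespace NetworkHamiltonian

variable {N : ℕ} {E : Type*} {Γ : EmbeddedNetwork N E} {H : NetworkHamiltonian Γ} {a : ℝ}

lemma isSubsolution_iff_isDominated [Finite E] (ha : H.Admissible a)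
    {u : EuclideanSpace ℝ (Fin N) → ℝ} : H.IsSubsolution a u ↔ H.IsDominated a u := by
  refine ⟨fun ⟨hc, hu⟩ e s hs t ht => ?_, fun hu =>
    ⟨Γ.isContinuous_of_continuousOn_comp_arc fun e => hu.continuousOn ha e,
      fun e => hu.viscositySubsolution ha e⟩⟩
  wlog hst : s ≤ t generalizing e s t
  · have := this (Γ.rev e) (1 - s) (one_sub_mem_unit hs) (1 - t) (one_sub_mem_unit ht)
      (by linarith [not_le.1 hst])
    rwa [cost_rev, Γ.arc_rev_one_sub e hs, Γ.arc_rev_one_sub e ht] at this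
  · exact increment_le_cost_of_subsolution ha e (hc.continuousOn_comp_arc Γ e) (hu e) hs.1 hst ht.2

/-! ### Extension of dominated functions -/

/-- A McShane extension, arc by arc: the infimum over the prescribed points of the value plus the
cost of leaving them. As K contains the vertices, different arcs do not interact. -/
lemma exists_isDominated_extension (ha : H.Admissible a) {K : Set (EuclideanSpace ℝ (Fin N))}
    (hK : Γ.vertices ⊆ K) {v : EuclideanSpace ℝ (Fin N) → ℝ}
    (hv : ∀ e, ∀ p ∈ Icc (0 : ℝ) 1, ∀ q ∈ Icc (0 : ℝ) 1, Γ.arc e p ∈ K → Γ.arc e q ∈ K →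
      v (Γ.arc e q) ≤ v (Γ.arc e p) + H.cost a e p q) :
    ∃ u, H.IsDominated a u ∧ ∀ x ∈ K ∩ Γ.carrier, u x = v x := by
  set I : E → Set ℝ := fun e => {p | p ∈ Icc (0 : ℝ) 1 ∧ Γ.arc e p ∈ K} with hI
  set f : E → ℝ → ℝ := fun e s => ⨅ p : I e, (v (Γ.arc e p) + H.cost a e p s) with hf
  have h0 : ∀ e, (0 : ℝ) ∈ I e := fun e => ⟨by simp, hK (Γ.origin_mem_vertices e)⟩
  have hne : ∀ e, Nonempty (I e) := fun e => ⟨⟨0, h0 e⟩⟩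
  have hbdd : ∀ e, ∀ s ∈ Icc (0 : ℝ) 1,
      BddBelow (range fun p : I e => v (Γ.arc e p) + H.cost a e p s) := by
    intro e s hs
    -- The initial vertex belongs to K, so compatibility there and the triangle inequality bound all
    -- competitors from below.
    refine ⟨v (Γ.arc e 0) - H.cost a e s 0, ?_⟩
    rintro _ ⟨⟨p, hp⟩, rfl⟩
    have h1 := hv e p hp.1 0 (h0 e).1 hp.2 (h0 e).2
    have h2 := cost_triangle ha e hp.1 hs (h0 e).1
    simp only
    linarith
  have hval : ∀ e, ∀ s ∈ I e, f e s = v (Γ.arc e s) := by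
    intro e s hs
    refine le_antisymm ((ciInf_le (hbdd e s hs.1) ⟨s, hs⟩).trans (by simp)) ?_
    exact le_ciInf fun p => hv e p p.2.1 s hs.1 p.2.2 hs.2
  have hdom : ∀ e, ∀ s ∈ Icc (0 : ℝ) 1, ∀ t ∈ Icc (0 : ℝ) 1,
      f e t ≤ f e s + H.cost a e s t := by
    intro e s hs t ht
    rw [← sub_le_iff_le_add]
    refine le_ciInf fun p => ?_
    have h1 : f e t ≤ v (Γ.arc e p) + H.cost a e p t := ciInf_le (hbdd e t ht) p
    have h2 := cost_triangle ha e p.2.1 hs ht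
    linarith
  have hmem : ∀ e, ∀ p, p ∈ I e → 1 - p ∈ I (Γ.rev e) := fun e p hp =>
    ⟨one_sub_mem_unit hp.1, by rw [Γ.arc_rev_one_sub e hp.1]; exact hp.2⟩
  have hle : ∀ e, ∀ s ∈ Icc (0 : ℝ) 1, f (Γ.rev e) (1 - s) ≤ f e s := by
    intro e s hs
    refine le_ciInf fun p => ?_
    refine (ciInf_le (hbdd (Γ.rev e) _ (one_sub_mem_unit hs)) ⟨1 - p, hmem e p p.2⟩).trans ?_
    simp only
    rw [cost_rev, Γ.arc_rev_one_sub e p.2.1]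
  have hrev : ∀ e, ∀ s ∈ Icc (0 : ℝ) 1, f (Γ.rev e) s = f e (1 - s) := by
    intro e s hs
    refine le_antisymm ?_ ?_
    · have := hle e (1 - s) (one_sub_mem_unit hs)
      rwa [sub_sub_cancel] at this
    · have := hle (Γ.rev e) s hs
      rwa [Γ.rev_rev] at this
  obtain ⟨u, hu⟩ := Γ.exists_glued (f := f) (v := v) (fun e => hval e 0 (h0 e)) hrev
  refine ⟨u, fun e s hs t ht => ?_, ?_⟩
  · rw [hu e s hs, hu e t ht]
    exact hdom e s hs t ht
  · rintro x ⟨hxK, hx⟩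
    obtain ⟨e, s, hs, rfl⟩ := Γ.mem_carrier.1 hx
    rw [hu e s hs, hval e s ⟨hs, hxK⟩]

end NetworkHamiltonian

namespace NetworkHamiltonian

variable {N : ℕ} {E : Type*} {Γ : EmbeddedNetwork N E} (H : NetworkHamiltonian Γ)

/-! ### Admissible levels -/

/-- Coercivity is assumed for each s only; quasiconvexity makes it locally uniform. Since H exceeds
its value at 0 at both m < 0 and M > 0, also for t near s, a slope outside [m,M] with value at most
b would bound H at m or M. This leaves a compact set of slopes. -/
lemma eventually_forall_lt (e : E) {s b : ℝ} (hs : s ∈ Icc (0 : ℝ) 1)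
    (hb : ∀ p, b < H.toFun e s p) : ∀ᶠ t in 𝓝[Icc 0 1] s, ∀ p, b < H.toFun e t p := by
  have hh := H.profile e hs
  obtain ⟨M, hM, hM0⟩ := ((hh.tendsto_atTop.eventually_gt_atTop (H.toFun e s 0)).and
    (eventually_gt_atTop 0)).exists
  obtain ⟨m, hm, hm0⟩ := ((hh.tendsto_atBot.eventually_gt_atTop (H.toFun e s 0)).and
    (eventually_lt_atBot 0)).exists
  have hG : Continuous fun z : ℝ × ℝ => H.toFun e (projIcc 0 1 zero_le_one z.1) z.2 := by
    have h1 := (H.continuousOn e).comp_continuous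
      (f := fun z : ℝ × ℝ => ((projIcc (0 : ℝ) 1 zero_le_one z.1 : ℝ), z.2))
      (by fun_prop) fun z => ⟨(projIcc (0 : ℝ) 1 zero_le_one z.1).2, mem_univ _⟩
    exact h1
  have hproj : ∀ t ∈ Icc (0 : ℝ) 1, (projIcc (0 : ℝ) 1 zero_le_one t : ℝ) = t := fun t ht => by
    rw [projIcc_of_mem _ ht]
  have h1 : ∀ᶠ t in 𝓝 s, ∀ p ∈ Icc m M, b < H.toFun e (projIcc 0 1 zero_le_one t) p := by
    refine isCompact_Icc.eventually_forall_of_forall_eventually fun p _ => ?_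
    exact (hG.tendsto (s, p)).eventually (lt_mem_nhds (by simpa [hproj s hs] using hb p))
  have hc := H.continuousOn_left e
  filter_upwards [h1.filter_mono nhdsWithin_le_nhds, (hc 0 s hs).eventually_lt (hc M s hs) hM,
    (hc 0 s hs).eventually_lt (hc m s hs) hm, self_mem_nhdsWithin] with t h1 h2 h3 ht p
  rw [hproj t ht] at h1
  have ht' := H.profile e ht
  by_cases hp : p ∈ Icc m M
  · exact h1 p hp
  by_contra hcon
  push Not at hcon
  rcases not_and_or.1 hp with hp | hp
  · have h4 := ht'.le_of_mem_Icc (a := max (H.toFun e t 0) b) (hcon.trans (le_max_right _ _))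
      (le_max_left _ _) (not_le.1 hp).le hm0.le
    exact absurd h4 (not_le.2 (max_lt h3 (h1 m ⟨le_rfl, by linarith⟩)))
  · have h4 := ht'.le_of_mem_Icc (a := max (H.toFun e t 0) b)
      (le_max_left _ _) (hcon.trans (le_max_right _ _)) hM0.le (not_le.1 hp).le
    exact absurd h4 (not_le.2 (max_lt h2 (h1 M ⟨by linarith, le_rfl⟩)))

lemma exists_touching_point {w : ℝ → ℝ} {α β : ℝ} (hαβ : α < β) (hw : ContinuousOn w (Icc α β)) :
    ∃ r ∈ Ioo α β, ∃ φ : ℝ → ℝ, ContDiff ℝ 1 φ ∧ φ r = w r ∧ ∀ t ∈ Icc α β, w t ≤ φ t := by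
  set m := (α + β) / 2 with hm
  -- With this coefficient, w minus the parabola is smaller at α and β than at the midpoint, so it
  -- has an interior maximum.
  set K := (|w α - w m| + |w β - w m| + 1) / ((β - α) / 2) ^ 2 with hK
  have hd : 0 < ((β - α) / 2) ^ 2 := by
    have : 0 < (β - α) / 2 := by linarith
    positivity
  have hKd : K * ((β - α) / 2) ^ 2 = |w α - w m| + |w β - w m| + 1 := by
    rw [hK, div_mul_cancel₀ _ hd.ne']
  obtain ⟨r, hr, hmax⟩ := isCompact_Icc.exists_isMaxOn (s := Icc α β) ⟨α, left_mem_Icc.2 hαβ.le⟩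
    (f := fun x => w x - K * (x - m) ^ 2) (hw.sub (by fun_prop))
  have h1 : w m - K * (m - m) ^ 2 ≤ w r - K * (r - m) ^ 2 :=
    hmax ⟨by rw [hm]; linarith, by rw [hm]; linarith⟩
  have h2 := le_abs_self (w α - w m)
  have h3 := le_abs_self (w β - w m)
  have h4 := abs_nonneg (w α - w m)
  have h5 := abs_nonneg (w β - w m)
  refine ⟨r, ⟨lt_of_le_of_ne hr.1 ?_, lt_of_le_of_ne hr.2 ?_⟩,
    fun x => w r + K * (x - m) ^ 2 - K * (r - m) ^ 2, by fun_prop, by ring, fun t ht => ?_⟩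
  · rintro rfl
    rw [show α - m = -((β - α) / 2) by rw [hm]; ring, neg_sq, hKd] at h1
    simp only [sub_self] at h1
    linarith
  · rintro rfl
    rw [show r - m = (r - α) / 2 by rw [hm]; ring, hKd] at h1
    simp only [sub_self] at h1
    linarith
  · have : w t - K * (t - m) ^ 2 ≤ w r - K * (r - m) ^ 2 := hmax ht
    linarith

/-- A continuous function is touched from above at points of every interval, so H > b for all slopes
near s would contradict the subsolution property. -/
lemma exists_apply_le_of_subsolution (e : E) {b : ℝ} {w : ℝ → ℝ} (hc : ContinuousOn w (Icc 0 1))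
    (hw : IsViscositySubsolution (H.toFun e) b w) {s : ℝ} (hs : s ∈ Icc (0 : ℝ) 1) :
    ∃ p, H.toFun e s p ≤ b := by
  by_contra hcon
  push Not at hcon
  obtain ⟨ε, hε, hball⟩ := Metric.mem_nhdsWithin_iff.1 (H.eventually_forall_lt e hs hcon)
  have hne : max 0 (s - ε) < min 1 (s + ε) :=
    max_lt (lt_min one_pos (by linarith [hs.1])) (lt_min (by linarith [hs.2]) (by linarith))
  obtain ⟨α, hα1, hα2⟩ := exists_between hne
  obtain ⟨β, hβ1, hβ2⟩ := exists_between hα2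
  rw [max_lt_iff] at hα1
  rw [lt_min_iff] at hβ2
  obtain ⟨r, hr, φ, hφ, hφr, hle⟩ := exists_touching_point hβ1
    (hc.mono (Icc_subset_Icc hα1.1.le hβ2.1.le))
  have hr01 : r ∈ Ioo (0 : ℝ) 1 := ⟨hα1.1.trans hr.1, hr.2.trans hβ2.1⟩
  have h1 := hw r hr01 φ hφ hφr ⟨min (r - α) (β - r), lt_min (by linarith [hr.1])
    (by linarith [hr.2]), fun t ht => hle t
      ⟨by linarith [ht.1.1, min_le_left (r - α) (β - r)],
        by linarith [ht.1.2, min_le_right (r - α) (β - r)]⟩⟩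
  exact absurd h1 (not_le.2 (hball ⟨by
    rw [Metric.mem_ball, Real.dist_eq, abs_lt]; exact ⟨by linarith [hr.1], by linarith [hr.2]⟩,
    Ioo_subset_Icc_self hr01⟩ _))

lemma exists_forall_apply_zero_le (e : E) : ∃ b, ∀ s ∈ Icc (0 : ℝ) 1, H.toFun e s 0 ≤ b := by
  obtain ⟨b, hb⟩ := (isCompact_Icc.image_of_continuousOn (H.continuousOn_left e 0)).bddAbove
  exact ⟨b, fun s hs => hb ⟨s, hs, rfl⟩⟩

lemma iInf_le_aArc (e : E) {s : ℝ} (hs : s ∈ Icc (0 : ℝ) 1) :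
    ⨅ p, H.toFun e s p ≤ H.aArc e := by
  obtain ⟨b, hb⟩ := H.exists_forall_apply_zero_le e
  refine le_ciSup (f := fun s : Icc (0 : ℝ) 1 => ⨅ p : ℝ, H.toFun e s p) ⟨b, ?_⟩ ⟨s, hs⟩
  rintro _ ⟨t, rfl⟩
  exact (ciInf_le (H.profile e t.2).bddBelow_range 0).trans (hb t t.2)

lemma iInf_le_cArc (e : E) {s : ℝ} (hs : s ∈ Icc (0 : ℝ) 1) :
    ⨅ p, H.toFun e s p ≤ H.cArc e := by
  refine le_csInf ?_ ?_
  -- Constants are periodic subsolutions at level b, so the infimum defining c_γ runs over a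
  -- nonempty set.
  · obtain ⟨b, hb⟩ := H.exists_forall_apply_zero_le e
    refine ⟨b, fun _ => 0, continuousOn_const, rfl, fun r hr φ hφ hφr ⟨δ, hδ, hle⟩ => ?_⟩
    have hmin : IsLocalMin φ r := by
      filter_upwards [Ioo_mem_nhds (show r - δ < r by linarith) (show r < r + δ by linarith),
        Ioo_mem_nhds hr.1 hr.2] with t h1 h2
      rw [hφr]
      exact hle t ⟨h1, h2⟩
    rw [hmin.deriv_eq_zero]
    exact hb r (Ioo_subset_Icc_self hr)
  · rintro b ⟨w, hc, -, hw⟩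
    obtain ⟨p, hp⟩ := H.exists_apply_le_of_subsolution e hc hw hs
    exact (ciInf_le (H.profile e hs).bddBelow_range p).trans hp

lemma aArc_le_cArc (e : E) : H.aArc e ≤ H.cArc e :=
  ciSup_le fun s => H.iInf_le_cArc e s.2

lemma aArc_le_aZero [Finite E] (e : E) : H.aArc e ≤ H.aZero := by
  classical
  refine le_trans ?_ (le_ciSup (Set.finite_range _).bddAbove e)
  split_ifs
  · exact H.aArc_le_cArc e
  · exact le_rfl

lemma admissible_of_aZero_le [Finite E] {a : ℝ} (ha : H.aZero ≤ a) : H.Admissible a := by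
  intro e s hs
  obtain ⟨p, hp⟩ := (H.profile e hs).exists_eq_iInf
  exact ⟨p, hp.trans_le (((H.iInf_le_aArc e hs).trans (H.aArc_le_aZero e)).trans ha)⟩

variable {H}

/-- At a level `a ≥ a₀`, the level sets of the Hamiltonian of an arc are either singletons for all `s` or for no `s`. -/
lemma MinConstant.dichotomy [Finite E] (hH : H.MinConstant) {a : ℝ} (ha : H.aZero ≤ a) (e : E) :
    (∀ s ∈ Icc (0 : ℝ) 1, H.sigmaMinus a e s = H.sigmaPlus a e s) ∨
      ∀ s ∈ Icc (0 : ℝ) 1, H.sigmaMinus a e s < H.sigmaPlus a e s := by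
  have hadm := H.admissible_of_aZero_le ha
  rcases ((H.aArc_le_aZero e).trans ha).eq_or_lt with heq | hlt
  · left
    have h0 : H.aArc e = H.aZero := le_antisymm (H.aArc_le_aZero e) (ha.trans heq.ge)
    intro s hs
    -- Here a = a_γ = a₀, so the minimum is a for every s, and no slope gives a smaller value.
    have hmin : ⨅ p, H.toFun e s p = a := by
      rw [← heq]
      refine le_antisymm (H.iInf_le_aArc e hs) (ciSup_le fun t => ?_)
      exact (hH e h0 t t.2 s hs).le
    refine (sigmaMinus_le_sigmaPlus hadm e hs).eq_or_lt.resolve_right fun hlt => ?_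
    obtain ⟨p, hp1, hp2⟩ := exists_between hlt
    exact absurd (apply_lt_of_mem hadm e hs hp1 hp2) (not_lt.2 (hmin.symm.trans_le
      (ciInf_le (H.profile e hs).bddBelow_range p)))
  · right
    intro s hs
    obtain ⟨p, hp⟩ := (H.profile e hs).exists_eq_iInf
    have hpa : H.toFun e s p < a := hp.trans_lt ((H.iInf_le_aArc e hs).trans_lt hlt)
    refine lt_of_le_of_lt (sigmaMinus_le e hs hpa.le)
      (lt_of_le_of_ne (le_sigmaPlus e hs hpa.le) ?_)
    intro h
    have := apply_sigmaPlus hadm e hs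
    rw [← h] at this
    exact hpa.ne this

end NetworkHamiltonian

/-! ### Chains of edges and their costs -/

namespace EmbeddedNetwork

variable {N : ℕ} {E : Type*} {Γ : EmbeddedNetwork N E}

lemma Chain.append {x y z : EuclideanSpace ℝ (Fin N)} {ξ η : List E} (h : Γ.Chain x ξ y)
    (h' : Γ.Chain y η z) : Γ.Chain x (ξ ++ η) z := by
  induction ξ generalizing x with
  | nil => cases h; exact h'
  | cons e ξ ih => exact ⟨h.1, ih h.2⟩

lemma chain_singleton (e : E) : Γ.Chain (Γ.origin e) [e] (Γ.terminal e) := ⟨rfl, rfl⟩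

end EmbeddedNetwork

namespace NetworkHamiltonian

variable {N : ℕ} {E : Type*} {Γ : EmbeddedNetwork N E} {H : NetworkHamiltonian Γ} {a : ℝ}

lemma sigmaPath_append (ξ η : List E) :
    H.sigmaPath a (ξ ++ η) = H.sigmaPath a ξ + H.sigmaPath a η := by
  simp [sigmaPath]

lemma sigmaPath_cons (e : E) (ξ : List E) :
    H.sigmaPath a (e :: ξ) = H.sigma a e + H.sigmaPath a ξ := by
  simp [sigmaPath]

@[simp] lemma sigmaPath_nil : H.sigmaPath a [] = 0 := rfl

@[simp] lemma sigmaPath_singleton (e : E) : H.sigmaPath a [e] = H.sigma a e := by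
  simp [sigmaPath]

lemma IsDiscreteSubsolution.le_of_chain {u : EuclideanSpace ℝ (Fin N) → ℝ}
    (hu : H.IsDiscreteSubsolution a u) {x y : EuclideanSpace ℝ (Fin N)} {ξ : List E}
    (h : Γ.Chain x ξ y) : u y ≤ u x + H.sigmaPath a ξ := by
  induction ξ generalizing x with
  | nil => cases h; simp
  | cons e ξ ih =>
    have h1 := ih h.2
    have h2 := hu e
    rw [h.1] at h2
    rw [sigmaPath_cons]
    linarith

lemma IsDominated.isDiscreteSubsolution {u : EuclideanSpace ℝ (Fin N) → ℝ}
    (hu : H.IsDominated a u) : H.IsDiscreteSubsolution a u := by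
  intro e
  have := hu e 0 (by simp) 1 (by simp)
  rwa [cost_zero_one, ← Γ.terminal_eq] at this

/-! ### Dependence on the level -/

lemma sigmaPlus_mono (ha : H.Admissible a) {b : ℝ} (hab : a ≤ b) (e : E) {s : ℝ}
    (hs : s ∈ Icc (0 : ℝ) 1) : H.sigmaPlus a e s ≤ H.sigmaPlus b e s :=
  le_sigmaPlus e hs ((apply_sigmaPlus ha e hs).trans_le hab)

lemma slope_mono (ha : H.Admissible a) {b : ℝ} (hab : a ≤ b) (e : E) (s : ℝ) :
    H.slope a e s ≤ H.slope b e s :=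
  sigmaPlus_mono ha hab e (projIcc (0 : ℝ) 1 zero_le_one s).2

/-- Continuity from the right in the level is enough, since the critical value is approached from
above. -/
lemma tendsto_slope (ha : H.Admissible a) (e : E) (s : ℝ) :
    Tendsto (fun b => H.slope b e s) (𝓝[>] a) (𝓝 (H.slope a e s)) := by
  set t := projIcc (0 : ℝ) 1 zero_le_one s
  refine tendsto_order.2 ⟨fun r hr => ?_, fun r hr => ?_⟩
  · filter_upwards [self_mem_nhdsWithin] with b hb
    exact hr.trans_le (slope_mono ha (le_of_lt hb) e s)
  · have h1 : a < H.toFun e t r := lt_apply_of_sigmaPlus_lt e t.2 hr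
    filter_upwards [Ioo_mem_nhdsGT h1] with b hb
    by_contra hcon
    have hb' := ha.mono hb.1.le
    have h2 := (H.profile e t.2).le_of_mem_Icc (a := b)
      ((apply_sigmaPlus ha e t.2).trans_le hb.1.le) (apply_sigmaPlus hb' e t.2).le
      (le_of_lt hr) (not_lt.1 hcon)
    exact absurd h2 (not_le.2 hb.2)

lemma tendsto_sigma (ha : H.Admissible a) (e : E) :
    Tendsto (fun b => H.sigma b e) (𝓝[>] a) (𝓝 (H.sigma a e)) := by
  simp only [← primitive_one, primitive]
  refine intervalIntegral.tendsto_integral_filter_of_dominated_convergence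
    (fun s => |H.slope a e s| + |H.slope (a + 1) e s|) ?_ ?_ ?_ ?_
  · filter_upwards [self_mem_nhdsWithin] with b hb
    exact (continuous_slope (ha.mono (le_of_lt hb)) e).aestronglyMeasurable
  · filter_upwards [Ioo_mem_nhdsGT (show a < a + 1 by linarith)] with b hb
    refine Eventually.of_forall fun s _ => ?_
    have h1 := slope_mono ha hb.1.le e s
    have h2 := slope_mono (ha.mono hb.1.le) hb.2.le e s
    rw [Real.norm_eq_abs]
    refine abs_le.2 ⟨?_, ?_⟩
    · linarith [neg_abs_le (H.slope a e s), abs_nonneg (H.slope (a + 1) e s)]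
    · linarith [le_abs_self (H.slope (a + 1) e s), abs_nonneg (H.slope a e s)]
  · refine Continuous.intervalIntegrable ?_ _ _
    have h1 := continuous_slope ha e
    have h2 := continuous_slope (ha.mono (show a ≤ a + 1 by linarith)) e
    fun_prop
  · exact Eventually.of_forall fun s _ => tendsto_slope ha e s

lemma tendsto_sigmaPath (ha : H.Admissible a) (ξ : List E) :
    Tendsto (fun b => H.sigmaPath b ξ) (𝓝[>] a) (𝓝 (H.sigmaPath a ξ)) := by
  induction ξ with
  | nil => exact tendsto_const_nhds
  | cons e ξ ih =>
    simp only [sigmaPath_cons]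
    exact (tendsto_sigma ha e).add ih

lemma sigma_mono (ha : H.Admissible a) {b : ℝ} (hab : a ≤ b) (e : E) :
    H.sigma a e ≤ H.sigma b e := by
  rw [← primitive_one, ← primitive_one]
  exact intervalIntegral.integral_mono_on zero_le_one
    ((continuous_slope ha e).intervalIntegrable _ _)
    ((continuous_slope (ha.mono hab) e).intervalIntegrable _ _) fun s _ => slope_mono ha hab e s

/-! ### The critical value -/

variable (H) in
lemma exists_supercritical_level [Finite E] :
    ∃ a, H.aZero ≤ a ∧ ∃ u, H.IsDiscreteSubsolution a u := by
  choose b hb using H.exists_forall_apply_zero_le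
  obtain ⟨B, hB⟩ := (Set.finite_range b).bddAbove
  -- Above all values H(s,0) the costs of edges are nonnegative, and 0 is a discrete subsolution.
  refine ⟨max H.aZero B, le_max_left _ _, 0, fun e => ?_⟩
  simp only [Pi.zero_apply, zero_add]
  refine intervalIntegral.integral_nonneg zero_le_one fun s hs => le_sigmaPlus e hs ?_
  exact ((hb e s hs).trans (hB ⟨e, rfl⟩)).trans (le_max_right _ _)

variable (H) in
lemma aZero_le_criticalValue [Finite E] : H.aZero ≤ H.criticalValue :=
  le_csInf H.exists_supercritical_level fun _ ha => ha.1

variable (H) in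
lemma admissible_criticalValue [Finite E] : H.Admissible H.criticalValue :=
  H.admissible_of_aZero_le H.aZero_le_criticalValue

/-- At every level above the critical one a discrete subsolution exists, and summing it along the
cycle gives the sign; then the level decreases to the critical value. -/
lemma sigmaPath_criticalValue_nonneg [Finite E] {x : EuclideanSpace ℝ (Fin N)} {ξ : List E}
    (h : Γ.Chain x ξ x) : 0 ≤ H.sigmaPath H.criticalValue ξ := by
  refine ge_of_tendsto (tendsto_sigmaPath H.admissible_criticalValue ξ) ?_
  filter_upwards [self_mem_nhdsWithin] with b hb
  obtain ⟨d, ⟨hd, u, hu⟩, hdb⟩ := exists_lt_of_csInf_lt H.exists_supercritical_level hb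
  have hub : H.IsDiscreteSubsolution b u := fun e =>
    (hu e).trans (by gcongr; exact sigma_mono (H.admissible_of_aZero_le hd) hdb.le e)
  linarith [hub.le_of_chain h]

/-- The infimum in the definition of the critical value is attained: the least cost of a chain from
a fixed vertex is a subsolution. It is finite because closing a chain by a fixed return path gives a
cycle of nonnegative cost. -/
lemma exists_isDiscreteSubsolution_criticalValue [Finite E] (hΓ : Γ.Connected) :
    ∃ u, H.IsDiscreteSubsolution H.criticalValue u := by
  rcases isEmpty_or_nonempty E with hE | ⟨⟨e₀⟩⟩
  · exact ⟨0, fun e => (hE.false e).elim⟩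
  set x₀ := Γ.origin e₀
  have hx₀ : x₀ ∈ Γ.vertices := Γ.origin_mem_vertices e₀
  set S : EuclideanSpace ℝ (Fin N) → Set ℝ := fun x =>
    {r | ∃ ξ, Γ.Chain x₀ ξ x ∧ H.sigmaPath H.criticalValue ξ = r} with hS
  have hbdd : ∀ x ∈ Γ.vertices, BddBelow (S x) := by
    intro x hx
    obtain ⟨η, -, hη⟩ := hΓ x hx x₀ hx₀
    refine ⟨-H.sigmaPath H.criticalValue η, ?_⟩
    rintro _ ⟨ξ, hξ, rfl⟩
    have := sigmaPath_criticalValue_nonneg (H := H) (hξ.append hη)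
    rw [sigmaPath_append] at this
    linarith
  refine ⟨fun x => sInf (S x), fun e => ?_⟩
  rw [← sub_le_iff_le_add]
  obtain ⟨η, -, hη⟩ := hΓ x₀ hx₀ _ (Γ.origin_mem_vertices e)
  refine le_csInf ⟨_, η, hη, rfl⟩ ?_
  rintro _ ⟨ξ, hξ, rfl⟩
  rw [sub_le_iff_le_add]
  refine csInf_le (hbdd _ (Γ.terminal_mem_vertices e))
    ⟨ξ ++ [e], hξ.append (EmbeddedNetwork.chain_singleton e), ?_⟩
  rw [sigmaPath_append, sigmaPath_singleton]

/-! ### Maximal dominated functions -/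

lemma exists_isDominated [Finite E] (hΓ : Γ.Connected) (y : EuclideanSpace ℝ (Fin N)) (α : ℝ) :
    ∃ u, H.IsDominated H.criticalValue u ∧ u y = α := by
  obtain ⟨v, hv⟩ := exists_isDiscreteSubsolution_criticalValue (H := H) hΓ
  obtain ⟨u, hu, -⟩ := exists_isDominated_extension H.admissible_criticalValue
    (K := Γ.vertices) Subset.rfl (v := v) (by
      intro e p hp q hq hpv hqv
      have h1 := hv e
      have h2 := hv (Γ.rev e)
      rw [Γ.terminal_rev, Γ.origin_rev] at h2
      rw [Γ.terminal_eq] at h1 h2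
      rcases Γ.eq_zero_or_one_of_mem_vertices hp hpv with rfl | rfl <;>
      rcases Γ.eq_zero_or_one_of_mem_vertices hq hqv with rfl | rfl
      · simp
      · rw [cost_zero_one]; exact h1
      · rw [cost_one_zero]; exact h2
      · simp)
  refine ⟨fun x => u x + (α - u y), fun e s hs t ht => ?_, by ring⟩
  linarith [hu e s hs t ht]

/-- The constant is the cost of one fixed route from y to x, so it does not depend on u; this makes
the supremum of normalized subsolutions finite. -/
lemma exists_forall_isDominated_le (hΓ : Γ.Connected) {x y : EuclideanSpace ℝ (Fin N)}
    (hx : x ∈ Γ.carrier) (hy : y ∈ Γ.carrier) :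
    ∃ C, ∀ u, H.IsDominated a u → u x ≤ u y + C := by
  obtain ⟨e, s, hs, rfl⟩ := Γ.mem_carrier.1 hx
  obtain ⟨e', t, ht, rfl⟩ := Γ.mem_carrier.1 hy
  obtain ⟨ξ, -, hξ⟩ := hΓ _ (Γ.origin_mem_vertices e') _ (Γ.origin_mem_vertices e)
  refine ⟨H.cost a e' t 0 + H.sigmaPath a ξ + H.cost a e 0 s, fun u hu => ?_⟩
  have h1 := hu e 0 (by simp) s hs
  have h2 := hu e' t ht 0 (by simp)
  have h3 := hu.isDiscreteSubsolution.le_of_chain hξ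
  unfold EmbeddedNetwork.origin at h3
  linarith

lemma exists_isMaximalSubsolution [Finite E] (hΓ : Γ.Connected)
    {y : EuclideanSpace ℝ (Fin N)} (hy : y ∈ Γ.carrier) (α : ℝ) :
    ∃ w, H.IsMaximalSubsolution H.criticalValue y α w := by
  have hadm := H.admissible_criticalValue
  set S : EuclideanSpace ℝ (Fin N) → Set ℝ := fun x =>
    {r | ∃ u, H.IsDominated H.criticalValue u ∧ u y = α ∧ u x = r} with hS
  obtain ⟨u₀, hu₀, hu₀y⟩ := exists_isDominated (H := H) hΓ y α
  have hbdd : ∀ x ∈ Γ.carrier, BddAbove (S x) := by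
    intro x hx
    obtain ⟨C, hC⟩ := exists_forall_isDominated_le (H := H) (a := H.criticalValue) hΓ hx hy
    refine ⟨α + C, ?_⟩
    rintro _ ⟨u, hu, huy, rfl⟩
    rw [← huy]
    exact hC u hu
  have hle : ∀ u, H.IsDominated H.criticalValue u → u y = α → ∀ x ∈ Γ.carrier,
      u x ≤ sSup (S x) := fun u hu huy x hx => le_csSup (hbdd x hx) ⟨u, hu, huy, rfl⟩
  refine ⟨fun x => sSup (S x), ⟨(isSubsolution_iff_isDominated hadm).2 fun e s hs t ht => ?_, ?_⟩,
    fun u hu => hle u ((isSubsolution_iff_isDominated hadm).1 hu)⟩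
  · refine csSup_le ⟨_, u₀, hu₀, hu₀y, rfl⟩ ?_
    rintro _ ⟨u, hu, huy, rfl⟩
    exact (hu e s hs t ht).trans (by gcongr; exact hle u hu huy _ (Γ.arc_mem_carrier e hs))
  · refine le_antisymm (csSup_le ⟨_, u₀, hu₀, hu₀y, rfl⟩ ?_) ?_
    · rintro _ ⟨u, -, huy, rfl⟩; exact huy.le
    · exact hu₀y.symm.trans_le (hle u₀ hu₀ hu₀y y hy)

end NetworkHamiltonian

/-! ### Finite sets of points on arcs, and neighbouring edges in chains -/

namespace EmbeddedNetwork

variable {N : ℕ} {E : Type*} (Γ : EmbeddedNetwork N E)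

lemma finite_vertices [Finite E] : Γ.vertices.Finite := finite_range _

lemma finite_setOf_arc_mem (e : E) {K : Set (EuclideanSpace ℝ (Fin N))} (hK : K.Finite) :
    {p | p ∈ Icc (0 : ℝ) 1 ∧ Γ.arc e p ∈ K}.Finite := by
  have h1 : {p | p ∈ Ico (0 : ℝ) 1 ∧ Γ.arc e p ∈ K}.Finite := by
    refine Set.Finite.of_injOn (f := Γ.arc e) (fun p hp => hp.2) (fun p hp q hq hpq => ?_) hK
    rcases lt_trichotomy p q with h | h | h
    · exact absurd (Γ.simple e p (Ico_subset_Icc_self hp.1) q (Ico_subset_Icc_self hq.1) h hpq).2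
        hq.1.2.ne
    · exact h
    · exact absurd (Γ.simple e q (Ico_subset_Icc_self hq.1) p (Ico_subset_Icc_self hp.1) h
        hpq.symm).2 hp.1.2.ne
  -- On a closed arc 0 and 1 are the same point, so injectivity holds on [0,1) and the parameter 1
  -- is added.
  refine (h1.insert 1).subset fun p hp => ?_
  rcases hp.1.2.eq_or_lt with h | h
  · exact Or.inl h
  · exact Or.inr ⟨⟨hp.1.1, h⟩, hp.2⟩

lemma mem_Ioo_of_notMem_vertices {e : E} {s : ℝ} (hs : s ∈ Icc (0 : ℝ) 1)
    (h : Γ.arc e s ∉ Γ.vertices) : s ∈ Ioo (0 : ℝ) 1 := by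
  refine ⟨lt_of_le_of_ne hs.1 ?_, lt_of_le_of_ne hs.2 ?_⟩
  · rintro rfl; exact h (Γ.origin_mem_vertices e)
  · rintro rfl; exact h (Γ.terminal_eq e ▸ Γ.terminal_mem_vertices e)

lemma arc_notMem_vertices {e : E} {s : ℝ} (hs : s ∈ Ioo (0 : ℝ) 1) : Γ.arc e s ∉ Γ.vertices := by
  intro h
  rcases Γ.eq_zero_or_one_of_mem_vertices (Ioo_subset_Icc_self hs) h with h | h
  · exact hs.1.ne' h
  · exact hs.2.ne h

lemma arc_injective_interior {e : E} {s t : ℝ} (hs : s ∈ Ioo (0 : ℝ) 1) (ht : t ∈ Icc (0 : ℝ) 1)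
    (h : Γ.arc e t = Γ.arc e s) : t = s := by
  rcases Γ.arc_eq_arc_interior hs ht h.symm with h | h
  · exact h.2
  · exact absurd h.1.symm (Γ.rev_ne e)

variable {Γ}

lemma Chain.exists_terminal_eq {x y : EuclideanSpace ℝ (Fin N)} {ξ : List E}
    (h : Γ.Chain x ξ y) (hξ : ξ ≠ []) : ∃ e ∈ ξ, Γ.terminal e = y := by
  induction ξ generalizing x with
  | nil => exact absurd rfl hξ
  | cons e ξ ih =>
    rcases eq_or_ne ξ [] with rfl | hne
    · exact ⟨e, by simp, h.2⟩
    · obtain ⟨e', he', h'⟩ := ih h.2 hne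
      exact ⟨e', List.mem_cons_of_mem _ he', h'⟩

lemma Chain.exists_predecessor {x y : EuclideanSpace ℝ (Fin N)} {ξ : List E} (h : Γ.Chain x ξ y)
    {e : E} (he : e ∈ ξ) : Γ.origin e = x ∨ ∃ e' ∈ ξ, Γ.terminal e' = Γ.origin e := by
  induction ξ generalizing x with
  | nil => simp at he
  | cons e₁ ξ ih =>
    rcases List.mem_cons.1 he with rfl | he
    · exact Or.inl h.1
    · rcases ih h.2 he with h' | ⟨e', he', h'⟩
      · exact Or.inr ⟨e₁, by simp, h'.symm⟩
      · exact Or.inr ⟨e', List.mem_cons_of_mem _ he', h'⟩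

end EmbeddedNetwork

namespace NetworkHamiltonian

variable {N : ℕ} {E : Type*} {Γ : EmbeddedNetwork N E} {H : NetworkHamiltonian Γ} {a : ℝ}

/-- A step that ends at an interior point of an arc runs along this arc, up to reversal, so it can
be written with the given orientation. -/
lemma exists_cost_eq_of_target (e : E) {e' : E} {s p q : ℝ} (hs : s ∈ Ioo (0 : ℝ) 1)
    (hp : p ∈ Icc (0 : ℝ) 1) (hq : q ∈ Icc (0 : ℝ) 1) (h : Γ.arc e' q = Γ.arc e s) :
    ∃ p' ∈ Icc (0 : ℝ) 1, Γ.arc e p' = Γ.arc e' p ∧ H.cost a e p' s = H.cost a e' p q := by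
  rcases Γ.arc_eq_arc_interior hs hq h.symm with ⟨rfl, rfl⟩ | ⟨rfl, rfl⟩
  · exact ⟨p, hp, rfl, rfl⟩
  · refine ⟨1 - p, one_sub_mem_unit hp, (Γ.arc_rev e p hp).symm, ?_⟩
    rw [← cost_rev e (1 - p), sub_sub_cancel]

lemma exists_cost_eq_of_source (e : E) {e' : E} {s p q : ℝ} (hs : s ∈ Ioo (0 : ℝ) 1)
    (hp : p ∈ Icc (0 : ℝ) 1) (hq : q ∈ Icc (0 : ℝ) 1) (h : Γ.arc e' p = Γ.arc e s) :
    ∃ q' ∈ Icc (0 : ℝ) 1, Γ.arc e q' = Γ.arc e' q ∧ H.cost a e s q' = H.cost a e' p q := by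
  rcases Γ.arc_eq_arc_interior hs hp h.symm with ⟨rfl, rfl⟩ | ⟨rfl, rfl⟩
  · exact ⟨q, hq, rfl, rfl⟩
  · refine ⟨1 - q, one_sub_mem_unit hq, (Γ.arc_rev e q hq).symm, ?_⟩
    rw [← cost_rev e s, sub_sub_cancel]

/-! ### Calibrated steps -/

lemma IsMaximalSubsolution.isDominated [Finite E] {y : EuclideanSpace ℝ (Fin N)} {α : ℝ}
    {w : EuclideanSpace ℝ (Fin N) → ℝ} (hw : H.IsMaximalSubsolution H.criticalValue y α w) :
    H.IsDominated H.criticalValue w :=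
  (isSubsolution_iff_isDominated H.admissible_criticalValue).1 hw.1.1

/-- If `y ∉ R`, the maximal subsolution cannot be raised on `R`: it increases by the full cost along some step
entering `R`. -/
lemma IsMaximalSubsolution.exists_calibrated_step [Finite E] {y : EuclideanSpace ℝ (Fin N)} {α : ℝ}
    {w : EuclideanSpace ℝ (Fin N) → ℝ} (hw : H.IsMaximalSubsolution H.criticalValue y α w)
    (hy : y ∈ Γ.carrier) {K R : Set (EuclideanSpace ℝ (Fin N))} (hKf : K.Finite)
    (hKv : Γ.vertices ⊆ K) (hyK : y ∈ K) (hRK : R ⊆ K) (hRc : R ⊆ Γ.carrier) (hR : R.Nonempty)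
    (hyR : y ∉ R) :
    ∃ e, ∃ p ∈ Icc (0 : ℝ) 1, ∃ q ∈ Icc (0 : ℝ) 1, Γ.arc e p ∈ K ∧ Γ.arc e p ∉ R ∧
      Γ.arc e q ∈ R ∧ w (Γ.arc e q) = w (Γ.arc e p) + H.cost H.criticalValue e p q := by
  by_contra hcon
  have hadm := H.admissible_criticalValue
  have hdom := hw.isDominated
  have hstrict : ∀ e, ∀ p ∈ Icc (0 : ℝ) 1, ∀ q ∈ Icc (0 : ℝ) 1, Γ.arc e p ∈ K → Γ.arc e p ∉ R →
      Γ.arc e q ∈ R → w (Γ.arc e q) < w (Γ.arc e p) + H.cost H.criticalValue e p q :=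
    fun e p hp q hq h1 h2 h3 => lt_of_le_of_ne (hdom e p hp q hq)
      fun h => hcon ⟨e, p, hp, q, hq, h1, h2, h3, h⟩
  set T : Set (E × ℝ × ℝ) := {z | z.2.1 ∈ Icc (0 : ℝ) 1 ∧ z.2.2 ∈ Icc (0 : ℝ) 1 ∧
    Γ.arc z.1 z.2.1 ∈ K ∧ Γ.arc z.1 z.2.1 ∉ R ∧ Γ.arc z.1 z.2.2 ∈ R} with hT
  set I : Set ℝ := ⋃ e, {p | p ∈ Icc (0 : ℝ) 1 ∧ Γ.arc e p ∈ K} with hI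
  have hIf : I.Finite := finite_iUnion fun e => Γ.finite_setOf_arc_mem e hKf
  have hTf : T.Finite := (finite_univ.prod (hIf.prod hIf)).subset fun z hz =>
    ⟨mem_univ _, mem_iUnion.2 ⟨z.1, hz.1, hz.2.2.1⟩,
      mem_iUnion.2 ⟨z.1, hz.2.1, hRK hz.2.2.2.2⟩⟩
  set g : E × ℝ × ℝ → ℝ := fun z =>
    w (Γ.arc z.1 z.2.1) + H.cost H.criticalValue z.1 z.2.1 z.2.2 - w (Γ.arc z.1 z.2.2) with hg
  -- There are finitely many steps from K \ R into R, all with positive slack, so w can be raised on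
  -- R by a common ε and then extended from K.
  obtain ⟨ε, hε, hgε⟩ : ∃ ε > 0, ∀ z ∈ T, ε ≤ g z := by
    rcases T.eq_empty_or_nonempty with h | h
    · exact ⟨1, one_pos, by simp [h]⟩
    · obtain ⟨z, hz, hmin⟩ := T.exists_min_image g hTf h
      exact ⟨g z, sub_pos.2 (hstrict _ _ hz.1 _ hz.2.1 hz.2.2.1 hz.2.2.2.1 hz.2.2.2.2), hmin⟩
  classical
  obtain ⟨u, hu, huv⟩ := exists_isDominated_extension hadm hKv
    (v := fun x => if x ∈ R then w x + ε else w x) (by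
      intro e p hp q hq hpK hqK
      have h1 := hdom e p hp q hq
      by_cases hpR : Γ.arc e p ∈ R <;> by_cases hqR : Γ.arc e q ∈ R <;>
        simp only [hpR, hqR, if_true, if_false]
      · linarith
      · linarith
      · have : ε ≤ g (e, p, q) := hgε _ ⟨hp, hq, hpK, hpR, hqR⟩
        simp only [hg] at this
        linarith
      · exact h1)
  obtain ⟨x, hx⟩ := hR
  have h1 : u y = α := by
    rw [huv y ⟨hyK, hy⟩, if_neg hyR, hw.1.2]
  have h2 := hw.2 u ((isSubsolution_iff_isDominated hadm).2 hu) h1 x (hRc hx)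
  rw [huv x ⟨hRK hx, hRc hx⟩, if_pos hx] at h2
  linarith

/-- Left of r, u lies below the primitive of σ⁺ that agrees with it at r. A function touching u from
below at r therefore has slope at least σ⁺. Only the left side is used, so r = 1 is covered. -/
lemma IsDominated.le_apply_of_calibrated (ha : H.Admissible a)
    {u : EuclideanSpace ℝ (Fin N) → ℝ} (hu : H.IsDominated a u) {e : E} {p r : ℝ}
    (hp : p ∈ Icc (0 : ℝ) 1) (hr : r ∈ Icc (0 : ℝ) 1) (hpr : p < r)
    (hcal : u (Γ.arc e r) = u (Γ.arc e p) + H.cost a e p r) {φ : ℝ → ℝ} (hφ : ContDiff ℝ 1 φ)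
    (hφr : φ r = u (Γ.arc e r)) {δ : ℝ} (hδ : 0 < δ)
    (hle : ∀ t ∈ Ioo (r - δ) r ∩ Ioo 0 1, φ t ≤ u (Γ.arc e t)) :
    a ≤ H.toFun e r (deriv φ r) := by
  refine le_apply_of_sigmaPlus_le ha e hr ?_
  rw [← slope_eq e hr]
  refine deriv_le_of_touching_left (hφ.differentiable one_ne_zero r).hasDerivAt
    ((hasDerivAt_primitive ha e r).add_const (φ r - H.primitive a e r)) (by ring) ?_
  filter_upwards [eventually_left_of_window hδ ⟨hp.1.trans_lt hpr, hr.2⟩,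
    Ioo_mem_nhdsLT hpr] with t ht htp
  have h1 := hle t ht
  have h2 := hu e p hp t (Ioo_subset_Icc_self ht.2)
  rw [cost_of_le htp.1.le] at h2
  rw [cost_of_le hpr.le] at hcal
  linarith

/-- Some arc segment ends at `x` along which `u` increases by the full cost. -/
def HasCalibratedSegment (H : NetworkHamiltonian Γ) (a : ℝ) (u : EuclideanSpace ℝ (Fin N) → ℝ)
    (x : EuclideanSpace ℝ (Fin N)) : Prop :=
  ∃ e, ∃ p ∈ Icc (0 : ℝ) 1, ∃ q ∈ Icc (0 : ℝ) 1, p < q ∧ Γ.arc e q = x ∧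
    u x = u (Γ.arc e p) + H.cost a e p q

lemma hasCalibratedSegment_of_ne {u : EuclideanSpace ℝ (Fin N) → ℝ} {e : E} {p q : ℝ}
    (hp : p ∈ Icc (0 : ℝ) 1) (hq : q ∈ Icc (0 : ℝ) 1) (hpq : p ≠ q)
    (h : u (Γ.arc e q) = u (Γ.arc e p) + H.cost a e p q) :
    H.HasCalibratedSegment a u (Γ.arc e q) := by
  rcases hpq.lt_or_gt with hlt | hlt
  · exact ⟨e, p, hp, q, hq, hlt, rfl, h⟩
  · exact ⟨Γ.rev e, 1 - p, one_sub_mem_unit hp, 1 - q, one_sub_mem_unit hq, by linarith,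
      Γ.arc_rev_one_sub e hq, by rw [cost_rev, Γ.arc_rev_one_sub e hp]; exact h⟩

lemma IsDominated.isSolution [Finite E] (ha : H.Admissible a) {u : EuclideanSpace ℝ (Fin N) → ℝ}
    (hu : H.IsDominated a u) (hcal : ∀ x ∈ Γ.carrier, H.HasCalibratedSegment a u x) :
    H.IsSolution a u := by
  refine ⟨((isSubsolution_iff_isDominated ha).2 hu).1, fun e =>
    ⟨hu.viscositySubsolution ha e, ?_⟩, fun x hx => ?_⟩
  · intro r hr φ hφ hφr ⟨δ, hδ, hle⟩
    have hr' := Ioo_subset_Icc_self hr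
    obtain ⟨e', p, hp, q, hq, hpq, hqr, h⟩ := hcal _ (Γ.arc_mem_carrier e hr')
    rcases Γ.arc_eq_arc_interior hr hq hqr.symm with ⟨rfl, rfl⟩ | ⟨rfl, rfl⟩
    · exact hu.le_apply_of_calibrated ha hp hr' hpq h hφ hφr hδ fun t ht =>
        hle t ⟨⟨ht.1.1, by linarith [ht.1.2]⟩, ht.2⟩
    · have h1 := hu.le_apply_of_calibrated ha hp hq hpq (hqr ▸ h) (φ := fun t => φ (1 - t))
        (by fun_prop) (by rw [hqr, sub_sub_cancel]; exact hφr) hδ (fun t ht => by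
          rw [Γ.arc_rev e t (Ioo_subset_Icc_self ht.2)]
          exact hle (1 - t) ⟨⟨by linarith [ht.1.2], by linarith [ht.1.1]⟩,
            by linarith [ht.2.2], by linarith [ht.2.1]⟩)
      rw [deriv_comp_const_sub, H.rev_eq e _ hq, sub_sub_cancel, neg_neg] at h1
      exact h1
  · obtain ⟨e, p, hp, q, hq, hpq, hqx, h⟩ := hcal x (Γ.vertices_subset_carrier hx)
    obtain rfl : q = 1 :=
      (Γ.eq_zero_or_one_of_mem_vertices hq (hqx ▸ hx)).resolve_left (hp.1.trans_lt hpq).ne'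
    refine ⟨e, (Γ.terminal_eq e).trans hqx, fun φ hφ hφr ⟨δ, hδ, hle⟩ => ?_⟩
    exact hu.le_apply_of_calibrated ha hp hq hpq (hqx ▸ h) hφ hφr hδ hle

/-! ### The Aubry set -/

/-- The inequalities along the chain add up with no slack, so each of them is an equality. -/
lemma IsDiscreteSubsolution.eq_of_mem_chain {u : EuclideanSpace ℝ (Fin N) → ℝ}
    (hu : H.IsDiscreteSubsolution a u) {x y : EuclideanSpace ℝ (Fin N)} {ξ : List E}
    (h : Γ.Chain x ξ y) (hle : u x + H.sigmaPath a ξ ≤ u y) {e : E} (he : e ∈ ξ) :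
    u (Γ.terminal e) = u (Γ.origin e) + H.sigma a e := by
  induction ξ generalizing x with
  | nil => simp at he
  | cons e₁ ξ ih =>
    have h1 := hu.le_of_chain h.2
    have h2 := hu e₁
    have h3 := h.1
    rw [sigmaPath_cons] at hle
    rw [h3] at h2
    rcases List.mem_cons.1 he with rfl | he
    · rw [h3]; linarith
    · exact ih h.2 (by linarith) he

lemma IsDiscreteSubsolution.eq_of_mem_aubryEdges {u : EuclideanSpace ℝ (Fin N) → ℝ}
    (hu : H.IsDiscreteSubsolution H.criticalValue u) {e : E} (he : e ∈ H.aubryEdges) :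
    u (Γ.terminal e) = u (Γ.origin e) + H.sigma H.criticalValue e := by
  obtain ⟨x, ξ, hξ, heξ, h0⟩ := he
  exact hu.eq_of_mem_chain hξ.2 (by rw [h0, add_zero]) heξ

lemma exists_predecessor_mem_aubryEdges {e : E} (he : e ∈ H.aubryEdges) :
    ∃ e' ∈ H.aubryEdges, Γ.terminal e' = Γ.origin e := by
  obtain ⟨x, ξ, hξ, heξ, h0⟩ := he
  rcases hξ.2.exists_predecessor heξ with h | ⟨e', he', h⟩
  · obtain ⟨e', he', h'⟩ := hξ.2.exists_terminal_eq hξ.1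
    exact ⟨e', ⟨x, ξ, hξ, he', h0⟩, h'.trans h.symm⟩
  · exact ⟨e', ⟨x, ξ, hξ, he', h0⟩, h⟩

lemma IsDominated.hasCalibratedSegment_of_mem_aubrySet {u : EuclideanSpace ℝ (Fin N) → ℝ}
    (hu : H.IsDominated H.criticalValue u) {x : EuclideanSpace ℝ (Fin N)} (hx : x ∈ H.aubrySet) :
    H.HasCalibratedSegment H.criticalValue u x := by
  have key : ∀ e ∈ H.aubryEdges, ∀ t ∈ Ioc (0 : ℝ) 1,
      H.HasCalibratedSegment H.criticalValue u (Γ.arc e t) := by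
    intro e he t ht
    have ht' := Ioc_subset_Icc_self ht
    refine ⟨e, 0, by simp, t, ht', ht.1, rfl, le_antisymm (hu e 0 (by simp) t ht') ?_⟩
    have h1 := hu.isDiscreteSubsolution.eq_of_mem_aubryEdges he
    rw [Γ.terminal_eq, ← cost_zero_one, EmbeddedNetwork.origin, cost_of_le zero_le_one] at h1
    have h2 := hu e t ht' 1 (by simp)
    rw [cost_of_le ht.2] at h2
    rw [cost_of_le ht.1.le]
    linarith
  obtain ⟨e, he, t, ht, rfl⟩ := hx
  -- At the initial vertex the calibrated segment is the preceding edge of the cycle.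
  rcases ht.1.eq_or_lt with rfl | h
  · obtain ⟨e', he', h'⟩ := exists_predecessor_mem_aubryEdges he
    have := key e' he' 1 ⟨one_pos, le_rfl⟩
    rwa [← Γ.terminal_eq, h'] at this
  · exact key e he t ⟨h, ht.2⟩

lemma IsMaximalSubsolution.isSolution [Finite E] {y : EuclideanSpace ℝ (Fin N)} {α : ℝ}
    {w : EuclideanSpace ℝ (Fin N) → ℝ} (hw : H.IsMaximalSubsolution H.criticalValue y α w)
    (hy : y ∈ Γ.carrier) (hyA : y ∈ H.aubrySet) : H.IsSolution H.criticalValue w := by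
  refine hw.isDominated.isSolution H.admissible_criticalValue fun x hx => ?_
  by_cases hxy : x = y
  · exact hxy ▸ hw.isDominated.hasCalibratedSegment_of_mem_aubrySet hyA
  obtain ⟨e, p, hp, q, hq, -, hpR, hqR, h⟩ := hw.exists_calibrated_step hy
    (K := insert x (insert y Γ.vertices)) (R := {x}) ((Γ.finite_vertices.insert y).insert x)
    ((subset_insert _ _).trans (subset_insert _ _)) (by simp) (by simp) (by simpa using hx)
    (singleton_nonempty x) (by simpa using fun h => hxy h.symm)
  rw [mem_singleton_iff] at hqR hpR
  subst hqR
  exact hasCalibratedSegment_of_ne hp hq (fun h => hpR (by rw [h])) h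

end NetworkHamiltonian

namespace NetworkHamiltonian

variable {N : ℕ} {E : Type*} {Γ : EmbeddedNetwork N E} {H : NetworkHamiltonian Γ} {a : ℝ}

/-! ### Arcs on which the level sets are nondegenerate -/

/-- `σ_a⁻ < σ_a⁺` on the whole arc. -/
def IsNondegenerate (H : NetworkHamiltonian Γ) (a : ℝ) (e : E) : Prop :=
  ∀ s ∈ Icc (0 : ℝ) 1, H.sigmaMinus a e s < H.sigmaPlus a e s

lemma IsNondegenerate.rev {e : E} (h : H.IsNondegenerate a e) : H.IsNondegenerate a (Γ.rev e) := by
  intro s hs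
  have := h (1 - s) (one_sub_mem_unit hs)
  simp only [sigmaMinus, sub_sub_cancel, Γ.rev_rev] at this ⊢
  linarith

lemma IsNondegenerate.cost_add_cost_pos (ha : H.Admissible a) {e : E}
    (h : H.IsNondegenerate a e) {s t : ℝ} (hs : s ∈ Icc (0 : ℝ) 1) (ht : t ∈ Icc (0 : ℝ) 1)
    (hst : s < t) : 0 < H.cost a e s t + H.cost a e t s := by
  have hd : ∀ s ∈ Icc (0 : ℝ) 1, HasDerivAt
      (fun s => H.primitive a e s - H.primitive a (Γ.rev e) (1 - s))
      (H.slope a e s - H.sigmaMinus a e s) s := fun s hs =>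
    (hasDerivAt_primitive ha e s).sub (hasDerivAt_primitive_rev ha e hs)
  have hmono : StrictMonoOn (fun s => H.primitive a e s - H.primitive a (Γ.rev e) (1 - s))
      (Icc 0 1) := by
    refine strictMonoOn_of_deriv_pos (convex_Icc _ _)
      (fun s hs => (hd s hs).continuousAt.continuousWithinAt) fun s hs => ?_
    have hs' := interior_subset hs
    rw [(hd s hs').deriv, slope_eq e hs', sub_pos]
    exact h s hs'
  have := hmono hs ht hst
  rw [cost_of_le hst.le, cost_of_ge hst.le]
  simp only at this
  linarith

lemma sigma_rev_of_degenerate {e : E}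
    (h : ∀ s ∈ Icc (0 : ℝ) 1, H.sigmaMinus a e s = H.sigmaPlus a e s) :
    H.sigma a (Γ.rev e) = -H.sigma a e := by
  unfold sigma
  have h1 := intervalIntegral.integral_comp_sub_left (a := 0) (b := 1)
    (H.sigmaPlus a (Γ.rev e)) (1 : ℝ)
  rw [sub_self, sub_zero] at h1
  rw [← h1, ← intervalIntegral.integral_neg]
  refine intervalIntegral.integral_congr fun s hs => ?_
  rw [uIcc_of_le zero_le_one] at hs
  have := h s hs
  unfold sigmaMinus at this
  linarith

lemma mem_aubryEdges_of_degenerate {e : E} (h : ∀ s ∈ Icc (0 : ℝ) 1,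
    H.sigmaMinus H.criticalValue e s = H.sigmaPlus H.criticalValue e s) : e ∈ H.aubryEdges := by
  refine ⟨Γ.origin e, [e, Γ.rev e], ⟨by simp, rfl, Γ.origin_rev e, Γ.terminal_rev e⟩, by simp, ?_⟩
  simp [sigmaPath, sigma_rev_of_degenerate h]

/-- Halfway between `σ_a⁻` and `σ_a⁺` the Hamiltonian is less than `a`, so a supersolution cannot be touched from below
by the function with these slopes. -/
lemma exists_strict_test_function (ha : H.Admissible a) {e : E} (h : H.IsNondegenerate a e) {r : ℝ}
    (hr : r ∈ Icc (0 : ℝ) 1) (β : ℝ) : ∃ φ : ℝ → ℝ, ContDiff ℝ 1 φ ∧ φ r = β ∧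
      H.toFun e r (deriv φ r) < a ∧ ∀ t ∈ Icc (0 : ℝ) 1, φ t ≤ β + H.cost a e r t := by
  refine ⟨fun t => β + ((H.primitive a e t - H.primitive a e r) +
    (H.primitive a (Γ.rev e) (1 - t) - H.primitive a (Γ.rev e) (1 - r))) / 2, ?_, by simp, ?_, ?_⟩
  · have h1 := contDiff_primitive ha e
    have h2 := contDiff_primitive ha (Γ.rev e)
    fun_prop
  · have hd := ((((hasDerivAt_primitive ha e r).sub_const (H.primitive a e r)).add
      ((hasDerivAt_primitive_rev ha e hr).sub_const
        (H.primitive a (Γ.rev e) (1 - r)))).div_const 2).const_add β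
    have hlt := h r hr
    have h1 : deriv (fun t => β + ((H.primitive a e t - H.primitive a e r) +
      (H.primitive a (Γ.rev e) (1 - t) - H.primitive a (Γ.rev e) (1 - r))) / 2) r =
        (H.sigmaPlus a e r + H.sigmaMinus a e r) / 2 := by
      rw [← slope_eq e hr]; exact hd.deriv
    rw [h1]
    exact apply_lt_of_mem ha e hr (by linarith) (by linarith)
  · intro t ht
    have hm := monotoneOn_sub_primitive_rev ha e
    rcases le_total r t with hrt | hrt
    · have := hm hr ht hrt
      rw [cost_of_le hrt]
      simp only at this ⊢
      linarith
    · have := hm ht hr hrt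
      rw [cost_of_ge hrt]
      simp only at this ⊢
      linarith

/-- A step between vertices is realized by at most one edge. -/
lemma exists_chain_of_step {u : EuclideanSpace ℝ (Fin N) → ℝ} {e : E} {p q : ℝ}
    (hp : p ∈ Icc (0 : ℝ) 1) (hq : q ∈ Icc (0 : ℝ) 1) (hpv : Γ.arc e p ∈ Γ.vertices)
    (hqv : Γ.arc e q ∈ Γ.vertices) (h : u (Γ.arc e q) = u (Γ.arc e p) + H.cost a e p q) :
    ∃ ξ, Γ.Chain (Γ.arc e p) ξ (Γ.arc e q) ∧
      u (Γ.arc e q) = u (Γ.arc e p) + H.sigmaPath a ξ := by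
  rcases Γ.eq_zero_or_one_of_mem_vertices hp hpv with rfl | rfl <;>
  rcases Γ.eq_zero_or_one_of_mem_vertices hq hqv with rfl | rfl
  · exact ⟨[], rfl, by simp⟩
  · exact ⟨[e], ⟨rfl, Γ.terminal_eq e⟩, by rw [sigmaPath_singleton, ← cost_zero_one]; exact h⟩
  · exact ⟨[Γ.rev e], ⟨Γ.terminal_eq e, Γ.terminal_rev e⟩, by
      rw [sigmaPath_singleton, ← cost_one_zero]; exact h⟩
  · exact ⟨[], rfl, by simp⟩

/-! ### Maximal subsolutions which are solutions -/

section

variable [Finite E] {y : EuclideanSpace ℝ (Fin N)} {α : ℝ} {w : EuclideanSpace ℝ (Fin N) → ℝ}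

/-- Between `0` and `y = γ(r)` the maximal subsolution is calibrated by one of the two end points. -/
lemma IsMaximalSubsolution.calibrated_of_lt
    (hw : H.IsMaximalSubsolution H.criticalValue y α w) {e : E} {r s : ℝ}
    (hr : r ∈ Icc (0 : ℝ) 1) (hyr : Γ.arc e r = y) (hs : s ∈ Ioo 0 r) :
    w (Γ.arc e s) = w (Γ.arc e 0) + H.cost H.criticalValue e 0 s ∨
      w (Γ.arc e s) = w (Γ.arc e r) + H.cost H.criticalValue e r s := by
  have hy : y ∈ Γ.carrier := hyr ▸ Γ.arc_mem_carrier e hr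
  have hs1 : s ∈ Ioo (0 : ℝ) 1 := ⟨hs.1, hs.2.trans_le hr.2⟩
  have hs' := Ioo_subset_Icc_self hs1
  have hdom := hw.isDominated
  have hne : ∀ t ∈ Icc (0 : ℝ) 1, Γ.arc e t = Γ.arc e s → t = s := fun t ht h =>
    Γ.arc_injective_interior hs1 ht h
  obtain ⟨e', p, hp, q, hq, hpK, hpR, hqR, h⟩ := hw.exists_calibrated_step hy
    (K := insert (Γ.arc e s) (insert y Γ.vertices)) (R := {Γ.arc e s})
    ((Γ.finite_vertices.insert y).insert _)
    ((subset_insert _ _).trans (subset_insert _ _)) (by simp) (by simp)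
    (by simpa using Γ.arc_mem_carrier e hs') (singleton_nonempty _)
    (by rw [mem_singleton_iff, ← hyr]; exact fun h => hs.2.ne' (hne r hr h))
  obtain ⟨p', hp', hpe, hcost⟩ := exists_cost_eq_of_target (H := H) (a := H.criticalValue) e hs1
    hp hq hqR
  rw [mem_singleton_iff.1 hqR, ← hpe, ← hcost] at h
  rw [← hpe] at hpK hpR
  have hv : Γ.arc e p' ∈ Γ.vertices → w (Γ.arc e s) = w (Γ.arc e 0) + H.cost H.criticalValue e 0 s ∨
      w (Γ.arc e s) = w (Γ.arc e r) + H.cost H.criticalValue e r s := by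
    intro hv
    rcases Γ.eq_zero_or_one_of_mem_vertices hp' hv with rfl | rfl
    · exact Or.inl h
    -- A calibrated step coming from the end 1 passes through y before reaching s, and its part from
    -- y on is calibrated too.
    · refine Or.inr (le_antisymm (hdom e r hr s hs') ?_)
      have h1 := hdom e 1 hp' r hr
      rw [cost_of_ge hr.2] at h1
      rw [cost_of_ge hs'.2] at h
      rw [cost_of_ge hs.2.le]
      linarith
  rcases hpK with hpK | hpK | hpK
  · exact absurd hpK hpR
  · by_cases hyv : y ∈ Γ.vertices
    · exact hv (hpK ▸ hyv)
    · have hr1 := Γ.mem_Ioo_of_notMem_vertices hr (hyr ▸ hyv)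
      obtain rfl := Γ.arc_injective_interior hr1 hp' (hpK.trans hyr.symm)
      exact Or.inr h
  · exact hv hpK

/-- If calibration from 0 fails at r, it fails near r by continuity, and the only alternative there
is calibration from y itself. -/
lemma IsMaximalSubsolution.calibrated_or_eventually
    (hw : H.IsMaximalSubsolution H.criticalValue y α w) {e : E} {r : ℝ} (hr : r ∈ Ioc (0 : ℝ) 1)
    (hyr : Γ.arc e r = y) :
    w (Γ.arc e r) = w (Γ.arc e 0) + H.cost H.criticalValue e 0 r ∨
      ∃ δ > 0, ∀ s ∈ Ioo (r - δ) r ∩ Ioo 0 1,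
        w (Γ.arc e s) = w (Γ.arc e r) + H.cost H.criticalValue e r s := by
  have hr' := Ioc_subset_Icc_self hr
  refine or_iff_not_imp_left.2 fun hne => ?_
  have hcont : Tendsto (fun s => w (Γ.arc e s) - (w (Γ.arc e 0) + H.cost H.criticalValue e 0 s))
      (𝓝[<] r) (𝓝 (w (Γ.arc e r) - (w (Γ.arc e 0) + H.cost H.criticalValue e 0 r))) := by
    refine Tendsto.sub ?_ ((((continuous_cost_right H.admissible_criticalValue e 0).tendsto
      r).mono_left nhdsWithin_le_nhds).const_add _)
    exact (hw.isDominated.continuousOn H.admissible_criticalValue e r hr').mono_left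
      (nhdsWithin_le_of_mem (mem_of_superset (Ioo_mem_nhdsLT hr.1) fun x hx =>
        ⟨hx.1.le, hx.2.le.trans hr.2⟩))
  have hev := hcont.eventually_ne (sub_ne_zero.2 hne)
  obtain ⟨l, hl, hlr⟩ := (mem_nhdsLT_iff_exists_Ioo_subset).1 hev
  refine ⟨r - l, sub_pos.2 hl, fun s hs => ?_⟩
  refine (hw.calibrated_of_lt hr' hyr ⟨hs.2.1, hs.1.2⟩).resolve_left fun h => ?_
  exact hlr ⟨by linarith [hs.1.1], hs.1.2⟩ (sub_eq_zero.2 h)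

lemma IsMaximalSubsolution.mem_aubrySet_of_vertex
    (hw : H.IsMaximalSubsolution H.criticalValue y α w) {e : E} (hey : Γ.terminal e = y)
    (he : w y = w (Γ.origin e) + H.sigma H.criticalValue e) : y ∈ H.aubrySet := by
  have hyv : y ∈ Γ.vertices := hey ▸ Γ.terminal_mem_vertices e
  have hy := Γ.vertices_subset_carrier hyv
  -- R consists of the vertices not reached from y by a calibrated chain. A calibrated step into R
  -- would prolong such a chain, so R is empty; a chain from y to the origin of e, followed by e, is
  -- the required cycle.
  set R : Set (EuclideanSpace ℝ (Fin N)) := {x | x ∈ Γ.vertices ∧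
    ¬∃ ξ, Γ.Chain y ξ x ∧ w x = w y + H.sigmaPath H.criticalValue ξ} with hR
  have hRV : R ⊆ Γ.vertices := fun x hx => hx.1
  have hRe : ¬R.Nonempty := by
    intro hne
    obtain ⟨e', p, hp, q, hq, hpK, hpR, hqR, h⟩ := hw.exists_calibrated_step hy
      Γ.finite_vertices Subset.rfl hyv hRV (hRV.trans Γ.vertices_subset_carrier) hne
      fun hyR => hyR.2 ⟨[], rfl, by simp⟩
    obtain ⟨ξ, hξ, hξw⟩ := exists_chain_of_step hp hq hpK (hRV hqR) h
    have hpR' : ∃ ξ, Γ.Chain y ξ (Γ.arc e' p) ∧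
        w (Γ.arc e' p) = w y + H.sigmaPath H.criticalValue ξ := by
      by_contra hc; exact hpR ⟨hpK, hc⟩
    obtain ⟨η, hη, hηw⟩ := hpR'
    exact hqR.2 ⟨η ++ ξ, hη.append hξ, by rw [sigmaPath_append]; linarith⟩
  obtain ⟨ξ, hξ, hξw⟩ : ∃ ξ, Γ.Chain y ξ (Γ.origin e) ∧
      w (Γ.origin e) = w y + H.sigmaPath H.criticalValue ξ := by
    by_contra hc
    exact hRe ⟨_, Γ.origin_mem_vertices e, hc⟩
  refine ⟨e, ⟨y, ξ ++ [e], ⟨by simp, hξ.append ⟨rfl, hey⟩⟩, by simp, ?_⟩, 1, by simp,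
    (Γ.terminal_eq e).symm.trans hey |>.symm⟩
  rw [sigmaPath_append, sigmaPath_singleton]
  linarith

lemma IsMaximalSubsolution.mem_aubryEdges_of_interior
    (hw : H.IsMaximalSubsolution H.criticalValue y α w) {e : E} {r : ℝ} (hr : r ∈ Ioo (0 : ℝ) 1)
    (hyr : Γ.arc e r = y) (hnd : H.IsNondegenerate H.criticalValue e)
    (hcal : w y = w (Γ.arc e 0) + H.cost H.criticalValue e 0 r) : e ∈ H.aubryEdges := by
  have hr' := Ioo_subset_Icc_self hr
  have hy : y ∈ Γ.carrier := hyr ▸ Γ.arc_mem_carrier e hr'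
  have hyv : y ∉ Γ.vertices := hyr ▸ Γ.arc_notMem_vertices hr
  -- R consists of the vertices not reached by a calibrated route leaving y through the end 1 of the
  -- arc.
  set R : Set (EuclideanSpace ℝ (Fin N)) := {x | x ∈ Γ.vertices ∧
    ¬(w (Γ.arc e 1) = w y + H.cost H.criticalValue e r 1 ∧
      ∃ ξ, Γ.Chain (Γ.arc e 1) ξ x ∧
        w x = w (Γ.arc e 1) + H.sigmaPath H.criticalValue ξ)} with hR
  have hRV : R ⊆ Γ.vertices := fun x hx => hx.1
  have hRe : ¬R.Nonempty := by
    intro hne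
    obtain ⟨e', p, hp, q, hq, hpK, hpR, hqR, h⟩ := hw.exists_calibrated_step hy
      (K := insert y Γ.vertices) (Γ.finite_vertices.insert y) (subset_insert _ _)
      (mem_insert _ _) (hRV.trans (subset_insert _ _)) (hRV.trans Γ.vertices_subset_carrier) hne
      fun hyR => hyv hyR.1
    rcases hpK with hpy | hpv
    · obtain ⟨q', hq', hqe, hcost⟩ := exists_cost_eq_of_source (H := H) (a := H.criticalValue) e hr
        hp hq (hpy.trans hyr.symm)
      rw [← hqe] at hqR
      rw [hpy, ← hqe, ← hcost] at h
      rcases Γ.eq_zero_or_one_of_mem_vertices hq' hqR.1 with rfl | rfl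
      -- Leaving y through the end 0 cannot be calibrated: with the calibrated arrival from 0, going
      -- back and forth would cost nothing.
      · have := hnd.cost_add_cost_pos H.admissible_criticalValue (s := 0) (by simp) hr' hr.1
        linarith
      · exact hqR.2 ⟨h, [], rfl, by simp⟩
    · obtain ⟨ξ, hξ, hξw⟩ := exists_chain_of_step hp hq hpv (hRV hqR) h
      by_cases hc : w (Γ.arc e 1) = w y + H.cost H.criticalValue e r 1 ∧
        ∃ ξ, Γ.Chain (Γ.arc e 1) ξ (Γ.arc e' p) ∧
          w (Γ.arc e' p) = w (Γ.arc e 1) + H.sigmaPath H.criticalValue ξ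
      · obtain ⟨h1, η, hη, hηw⟩ := hc
        exact hqR.2 ⟨h1, η ++ ξ, hη.append hξ, by rw [sigmaPath_append]; linarith⟩
      · exact hpR ⟨hpv, hc⟩
  obtain ⟨h1, ξ, hξ, hξw⟩ : w (Γ.arc e 1) = w y + H.cost H.criticalValue e r 1 ∧
      ∃ ξ, Γ.Chain (Γ.arc e 1) ξ (Γ.origin e) ∧
        w (Γ.origin e) = w (Γ.arc e 1) + H.sigmaPath H.criticalValue ξ := by
    by_contra hc
    exact hRe ⟨_, Γ.origin_mem_vertices e, hc⟩
  refine ⟨Γ.origin e, e :: ξ, ⟨by simp, rfl, (Γ.terminal_eq e).symm ▸ hξ⟩, by simp, ?_⟩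
  rw [sigmaPath_cons, ← cost_zero_one, cost_of_le zero_le_one]
  rw [cost_of_le hr.2.le] at h1
  rw [cost_of_le hr.1.le] at hcal
  unfold EmbeddedNetwork.origin at hξw
  linarith

lemma IsMaximalSubsolution.mem_aubrySet (hH : H.MinConstant)
    (hw : H.IsMaximalSubsolution H.criticalValue y α w) (hy : y ∈ Γ.carrier)
    (hsol : H.IsSolution H.criticalValue w) : y ∈ H.aubrySet := by
  have hadm := H.admissible_criticalValue
  have hdom := hw.isDominated
  by_cases hyv : y ∈ Γ.vertices
  · obtain ⟨e, hey, hsc⟩ := hsol.2.2 y hyv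
    refine hw.mem_aubrySet_of_vertex hey ?_
    rw [← hey, Γ.terminal_eq, ← cost_zero_one]
    rcases hH.dichotomy H.aZero_le_criticalValue e with hdeg | (hnd : H.IsNondegenerate H.criticalValue e)
    -- On a degenerate arc the two costs are opposite, so domination in both directions forces
    -- calibration.
    · have h1 := hdom e 0 (by simp) 1 (by simp)
      have h2 := hdom e 1 (by simp) 0 (by simp)
      rw [cost_one_zero, sigma_rev_of_degenerate hdeg, ← cost_zero_one] at h2
      unfold EmbeddedNetwork.origin
      linarith
    · refine (hw.calibrated_or_eventually ⟨one_pos, le_rfl⟩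
        ((Γ.terminal_eq e).symm.trans hey)).resolve_right fun ⟨δ, hδ, h⟩ => ?_
      -- Near 1, w is w(y) plus the cost of leaving y, hence lies above φ, which violates the state
      -- constraint.
      obtain ⟨φ, hφ, hφ1, hlt, hle⟩ := exists_strict_test_function hadm hnd (r := 1) (by simp)
        (w (Γ.arc e 1))
      refine absurd (hsc φ hφ hφ1 ⟨δ, hδ, fun t ht => ?_⟩) (not_le.2 hlt)
      exact (hle t (Ioo_subset_Icc_self ht.2)).trans_eq (h t ht).symm
  · obtain ⟨e, r, hr', hyr⟩ := Γ.mem_carrier.1 hy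
    have hr := Γ.mem_Ioo_of_notMem_vertices hr' (hyr ▸ hyv)
    rcases hH.dichotomy H.aZero_le_criticalValue e with hdeg | (hnd : H.IsNondegenerate H.criticalValue e)
    · exact ⟨e, mem_aubryEdges_of_degenerate hdeg, r, hr', hyr.symm⟩
    have hrr : 1 - r ∈ Ioo (0 : ℝ) 1 := ⟨by linarith [hr.2], by linarith [hr.1]⟩
    have hyr' : Γ.arc (Γ.rev e) (1 - r) = y := (Γ.arc_rev_one_sub e hr').trans hyr
    rcases hw.calibrated_or_eventually ⟨hr.1, hr.2.le⟩ hyr with h1 | ⟨δ₁, hδ₁, h1⟩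
    · exact ⟨e, hw.mem_aubryEdges_of_interior hr hyr hnd (hyr ▸ h1), r, hr', hyr.symm⟩
    rcases hw.calibrated_or_eventually ⟨hrr.1, hrr.2.le⟩ hyr' with h2 | ⟨δ₂, hδ₂, h2⟩
    · exact ⟨Γ.rev e, hw.mem_aubryEdges_of_interior hrr hyr' hnd.rev (hyr' ▸ h2), 1 - r,
        Ioo_subset_Icc_self hrr, hyr'.symm⟩
    -- Calibration fails from both ends, so w is w(y) plus the cost of leaving y on both sides, and
    -- φ contradicts the supersolution property at y.
    obtain ⟨φ, hφ, hφr, hlt, hle⟩ := exists_strict_test_function hadm hnd hr' (w (Γ.arc e r))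
    refine absurd ((hsol.2.1 e).2 r hr φ hφ hφr ⟨min δ₁ δ₂, lt_min hδ₁ hδ₂, fun t ht => ?_⟩)
      (not_le.2 hlt)
    have ht' := Ioo_subset_Icc_self ht.2
    have hm1 := min_le_left δ₁ δ₂
    have hm2 := min_le_right δ₁ δ₂
    refine (hle t ht').trans_eq ?_
    rcases lt_trichotomy t r with h | rfl | h
    · exact (h1 t ⟨⟨by linarith [ht.1.1], h⟩, ht.2⟩).symm
    · simp
    · have := h2 (1 - t) ⟨⟨by linarith [ht.1.2], by linarith⟩, by linarith [ht.2.2],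
        by linarith [ht.2.1]⟩
      rw [cost_rev, Γ.arc_rev_one_sub e ht', Γ.arc_rev_one_sub e hr'] at this
      exact this.symm

end

end NetworkHamiltonian

/-- On a finite connected embedded network, for every point `y` and every value `α` the maximal critical subsolution
taking the value `α` at `y` exists, and it is a critical solution on the whole network iff `y` is in the Aubry set. -/
theorem proposition6p4 {N : ℕ} {E : Type*} [Finite E] (Γ : EmbeddedNetwork N E) (hΓ : Γ.Connected)
    (H : NetworkHamiltonian Γ) (hH : H.MinConstant)
    (y : EuclideanSpace ℝ (Fin N)) (hy : y ∈ Γ.carrier) (α : ℝ) :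
    (∃ w, H.IsMaximalSubsolution H.criticalValue y α w) ∧
    ∀ w, H.IsMaximalSubsolution H.criticalValue y α w →
      (H.IsSolution H.criticalValue w ↔ y ∈ H.aubrySet) :=
  ⟨NetworkHamiltonian.exists_isMaximalSubsolution hΓ hy α, fun _ hw =>
    ⟨hw.mem_aubrySet hH hy, hw.isSolution hy⟩⟩
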